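/- **Theorem (percolation on $\mathbb Z^d$ and $\mathbb T^d$).** For an infinite graph $G=(V,E)$, an integer $k\ge 0$ and $p\in(0,1)$, let $\mathcal A(G,k,p)$ be the set of $k$-wise independent site percolations on $G$ with marginal $p$, that is, of all probability measures $Q$ on $\{\text{open},\text{closed}\}^V$ (with the product $\sigma$-algebra) such that each vertex is open with $Q$-probability $p$ and the states of any at most $k$ vertices are independent under $Q$. An infinite open cluster is an infinite connected component of the subgraph of $G$ induced on the open vertices. Let $d\ge 1$, and let $G$ be either the lattice $\mathbb Z^d$ (with edges between points at $\ell^1$-distance $1$) or the infinite rooted $d$-ary tree $\mathbb T^d$ (in which every vertex has exactly $d$ children). Let $0<p<1$ and let $k\ge 0$ be an integer. Then: 1. if $d\ge 2$, there exists $Q\in\mathcal A(G,k,p)$ such that $Q$-almost surely there is an infinite open cluster; 2. there also exists a $Q\in\mathcal A(G,k,p)$ such that $Q$-almost surely there is no infinite open cluster. -/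

import Mathlib

open MeasureTheory ProbabilityTheory

/-- The hypercubic lattice `ℤ^d`: two points are adjacent iff their `ℓ¹`-distance is `1`. -/
def latticeGraph (d : ℕ) : SimpleGraph (Fin d → ℤ) where
  Adj x y := ∑ i, |x i - y i| = 1
  symm := ⟨fun x y h => by
    simpa only [abs_sub_comm] using h⟩
  loopless := ⟨fun x h => by simp at h⟩

/-- The infinite rooted `d`-ary tree. The vertices are the finite words over `Fin d`, the root is
the empty word, and the `d` children of a word `x` are the words `a :: x`. -/
def aryTree (d : ℕ) : SimpleGraph (List (Fin d)) where
  Adj x y := (∃ a, y = a :: x) ∨ (∃ a, x = a :: y)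
  symm := ⟨fun _ _ h => h.symm⟩
  loopless := ⟨fun x h => by
    rcases h with ⟨a, h⟩ | ⟨a, h⟩ <;> simpa using congrArg List.length h⟩

/-- The set of all `k`-wise independent (site) percolations on the vertex set `V` with marginal `p`:
probability measures on `{open, closed}^V` (with the product `σ`-algebra; `true` means open) under
which each vertex is open with probability `p` and the states of any at most `k` vertices are
independent. -/
def kwisePercolation (V : Type*) (k : ℕ) (p : ℝ) : Set (Measure (V → Bool)) :=
  {Q | IsProbabilityMeasure Q ∧
    (∀ v : V, Q {ω | ω v = true} = ENNReal.ofReal p) ∧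
    ∀ S : Finset V, S.card ≤ k → iIndepFun (fun (v : S) (ω : V → Bool) => ω v) Q}

/-- The configuration `ω` has an infinite open cluster: the subgraph of `G` induced on the open
vertices has an infinite connected component. -/
def HasInfiniteOpenCluster {V : Type*} (G : SimpleGraph V) (ω : V → Bool) : Prop :=
  ∃ C : (G.induce {v | ω v = true}).ConnectedComponent, C.supp.Infinite

/-! All four measures come from one induction on the order j of independence. At stage j there is a
law κ on the configurations of a finite cell that gives any at most j vertices the same open
probabilities as independent percolation, and that still forces a geometric property (almost surely,
or on average in the last case). Order 0 imposes nothing, so the induction starts from the all-open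
or the all-closed configuration.

To gain one order (`exists_boost`), split a larger region into cells and draw a label i from a
finite set. Cells in a set R i receive independent copies of κ, the other cells a compensating law.
If each cell is in R i for a small proportion of labels, `exists_complement` supplies this law so
that, averaged over i, each cell has exactly the product open probabilities, at all orders. Now take
j + 1 vertices. If no cell contains all of them, each cell contains at most j, and its contribution
is the product value whatever i is. If one cell contains all, the average over i is right.

It remains to choose sparse sets R i that transmit the geometric property to the larger cell. For no
percolation on the lattice they are thick walls (`Confines.coarsen`); for percolation they are grids
in two directions (`Links.coarsen`). The label of a cube varies from cube to cube, and positions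
coding several labels at once make neighbouring walls or grids fit together. For no percolation on
the tree, R i is one generation of blocks (`exists_blocking`). For percolation on the tree, all
blocks follow κ for one label and none for the others; this keeps the mean number of open paths
through a tall block above 1 (`exists_one_lt_meanPaths`). A second moment estimate
(`real_noPath_le`) then gives an infinite cluster almost surely.

Finally, independent copies of the last cell law tile the whole graph, which preserves the order of
independence. -/

open scoped ENNReal

/-! ### Independence expressed by probabilities of all-open events -/

/-- The event that all vertices of `S` are open. -/
def openOn {V : Type*} (S : Finset V) : Set (V → Bool) := {ω | ∀ v ∈ S, ω v = true}

theorem measurableSet_openOn {V : Type*} (S : Finset V) : MeasurableSet (openOn S) := by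
  have : openOn S = ⋂ v ∈ S, {ω : V → Bool | ω v = true} := by
    ext ω; simp [openOn]
  rw [this]
  exact Finset.measurableSet_biInter _ fun v _ =>
    measurableSet_eq_fun (measurable_pi_apply v) measurable_const

/-- A probability measure on configurations under which any at most `j` vertices are all open with
the same probability as under independent percolation with parameter `P`. -/
structure KWise {V : Type*} (j : ℕ) (P : ℝ≥0∞) (Q : Measure (V → Bool)) : Prop where
  prob : IsProbabilityMeasure Q
  openOn_eq : ∀ S : Finset V, S.card ≤ j → Q (openOn S) = P ^ S.card

/-- The event that v is open generates the σ-algebra of its state, so independence reduces to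
all-open events. Order k + 1 rather than k makes singletons available even for k = 0, which fixes
the marginals. -/
theorem KWise.mem_kwisePercolation {V : Type*} {k : ℕ} {p : ℝ} {Q : Measure (V → Bool)}
    (h : KWise (k + 1) (ENNReal.ofReal p) Q) : Q ∈ kwisePercolation V k p := by
  classical
  have hmarg : ∀ v : V, Q {ω | ω v = true} = ENNReal.ofReal p := fun v => by
    have := h.openOn_eq {v} (by simp)
    simpa [openOn] using this
  refine ⟨h.prob, hmarg, fun S hS => ?_⟩
  have := h.prob
  have hms : ∀ v : S, MeasurableSet {ω : V → Bool | ω v = true} := fun v =>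
    measurableSet_eq_fun (measurable_pi_apply (v : V)) measurable_const
  have h1 : iIndepSet (fun (v : S) => {ω : V → Bool | ω v = true}) Q := by
    rw [iIndepSet_iff_meas_biInter hms]
    intro T
    have h2 := h.openOn_eq (T.map (Function.Embedding.subtype _)) (by
      rw [Finset.card_map]
      have := T.card_le_univ
      simp at this
      omega)
    have h3 : openOn (T.map (Function.Embedding.subtype _)) =
        ⋂ v ∈ T, {ω : V → Bool | ω (v : V) = true} := by
      ext ω; simp [openOn]
    rw [h3, Finset.card_map] at h2
    rw [h2, Finset.prod_congr rfl fun (v : S) _ => hmarg v, Finset.prod_const]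
  have h2 := (iIndepSet_iff_iIndep _ _).1 h1
  rw [iIndepFun_iff_iIndep]
  convert h2 using 2 with v
  apply le_antisymm
  · rintro s ⟨t, -, rfl⟩
    have hg : MeasurableSet[MeasurableSpace.generateFrom {{ω : V → Bool | ω v = true}}]
        {ω : V → Bool | ω v = true} := MeasurableSpace.measurableSet_generateFrom rfl
    have key : (fun ω : V → Bool => ω v) ⁻¹' t =
        (if true ∈ t then {ω : V → Bool | ω v = true} else ∅) ∪
        (if false ∈ t then {ω : V → Bool | ω v = true}ᶜ else ∅) := by
      ext ω
      cases hω : ω v <;> by_cases h1 : true ∈ t <;> by_cases h2 : false ∈ t <;> simp [h1, h2, hω]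
    rw [key]
    refine @MeasurableSet.union _ (_) _ _ ?_ ?_ <;> split_ifs
    exacts [hg, @MeasurableSet.empty _ (_), @MeasurableSet.compl _ _ (_) hg,
      @MeasurableSet.empty _ (_)]
  · refine MeasurableSpace.generateFrom_le ?_
    rintro s rfl
    exact ⟨{true}, trivial, by ext; simp⟩

theorem KWise.comap {V V' : Type*} {j : ℕ} {P : ℝ≥0∞} {Q : Measure (V → Bool)} (h : KWise j P Q)
    {f : V' → V} (hf : Function.Injective f) : KWise j P (Q.map fun ω v => ω (f v)) := by
  have hm : Measurable fun (ω : V → Bool) (v : V') => ω (f v) :=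
    measurable_pi_lambda _ fun v => measurable_pi_apply _
  have := h.prob
  refine ⟨Measure.isProbabilityMeasure_map hm.aemeasurable, fun S hS => ?_⟩
  rw [Measure.map_apply hm (measurableSet_openOn S), ← Finset.card_map ⟨f, hf⟩,
    ← h.openOn_eq _ (by rwa [Finset.card_map])]
  congr 1
  ext ω
  simp [openOn]

/-! ### Independent cells -/

section Tile

variable {V W F : Type*}

/-- Assemble a configuration on `V` from configurations on the cells. -/
def glue (e : V ≃ W × F) (η : W → F → Bool) : V → Bool := fun v => η (e v).1 (e v).2

theorem measurable_glue (e : V ≃ W × F) : Measurable (glue e) :=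
  measurable_pi_lambda _ fun v => (measurable_pi_apply (e v).2).comp (measurable_pi_apply (e v).1)

/-- The configuration seen in the cell `w`. -/
def cell (e : V ≃ W × F) (ω : V → Bool) (w : W) : F → Bool := fun f => ω (e.symm (w, f))

theorem measurable_cell (e : V ≃ W × F) (w : W) : Measurable fun ω => cell e ω w :=
  measurable_pi_lambda _ fun f => measurable_pi_apply (e.symm (w, f))

@[simp] theorem cell_glue (e : V ≃ W × F) (η : W → F → Bool) (w : W) :
    cell e (glue e η) w = η w := by
  ext f; simp [cell, glue]

/-- The law of a configuration whose cells are independent with given laws. -/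
noncomputable def tileLaw (e : V ≃ W × F) (κ : W → Measure (F → Bool)) : Measure (V → Bool) :=
  (Measure.infinitePi κ).map (glue e)

instance (e : V ≃ W × F) (κ : W → Measure (F → Bool)) [∀ w, IsProbabilityMeasure (κ w)] :
    IsProbabilityMeasure (tileLaw e κ) :=
  Measure.isProbabilityMeasure_map (measurable_glue e).aemeasurable

open Classical in
theorem tileLaw_cells (e : V ≃ W × F) (κ : W → Measure (F → Bool))
    [∀ w, IsProbabilityMeasure (κ w)] (B : Finset W) (t : W → Set (F → Bool))
    (ht : ∀ w ∈ B, MeasurableSet (t w)) :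
    tileLaw e κ {ω | ∀ w ∈ B, cell e ω w ∈ t w} = ∏ w ∈ B, κ w (t w) := by
  have hm : MeasurableSet {ω | ∀ w ∈ B, cell e ω w ∈ t w} := by
    have : {ω | ∀ w ∈ B, cell e ω w ∈ t w} = ⋂ w ∈ B, (fun ω => cell e ω w) ⁻¹' t w := by
      ext; simp
    rw [this]
    exact Finset.measurableSet_biInter _ fun w hw => measurable_cell e w (ht w hw)
  rw [tileLaw, Measure.map_apply (measurable_glue e) hm, ← Measure.infinitePi_pi κ ht]
  congr 1
  ext η
  simp [Set.mem_pi]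

theorem tileLaw_ae_cell (e : V ≃ W × F) (κ : W → Measure (F → Bool))
    [∀ w, IsProbabilityMeasure (κ w)] (w : W) {p : (F → Bool) → Prop} (h : ∀ᵐ η ∂κ w, p η) :
    ∀ᵐ ω ∂tileLaw e κ, p (cell e ω w) := by
  have h1 : (tileLaw e κ).map (fun ω => cell e ω w) = κ w := by
    rw [tileLaw, Measure.map_map (measurable_cell e w) (measurable_glue e)]
    convert Measure.infinitePi_map_eval κ w using 2
    ext η : 1
    simp
  rw [← h1] at h
  exact ae_of_ae_map (measurable_cell e w).aemeasurable h

/-- The part of `S` in the cell `w`. -/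
noncomputable def fiberIn (e : V ≃ W × F) (S : Finset V) (w : W) : Finset F :=
  S.preimage (fun f => e.symm (w, f))
    (Function.Injective.injOn fun _ _ h => (Prod.ext_iff.1 (e.symm.injective h)).2)

theorem mem_fiberIn {e : V ≃ W × F} {S : Finset V} {w : W} {f : F} :
    f ∈ fiberIn e S w ↔ e.symm (w, f) ∈ S := by
  rw [fiberIn, Finset.mem_preimage]

open Classical in
theorem card_eq_sum_fiberIn (e : V ≃ W × F) (S : Finset V) :
    S.card = ∑ w ∈ S.image (fun v => (e v).1), (fiberIn e S w).card := by
  rw [Finset.card_eq_sum_card_image (fun v => (e v).1) S]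
  refine Finset.sum_congr rfl fun w _ => ?_
  refine Finset.card_bij' (fun v _ => (e v).2) (fun f _ => e.symm (w, f)) ?_ ?_ ?_ ?_
  · rintro v hv
    simp only [Finset.mem_filter] at hv
    rw [mem_fiberIn, ← hv.2]
    simpa using hv.1
  · intro f hf
    rw [mem_fiberIn] at hf
    simp [hf]
  · rintro v hv
    simp only [Finset.mem_filter] at hv
    simp [← hv.2]
  · simp

open Classical in
theorem tileLaw_openOn (e : V ≃ W × F) (κ : W → Measure (F → Bool))
    [∀ w, IsProbabilityMeasure (κ w)] (S : Finset V) :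
    tileLaw e κ (openOn S) =
      ∏ w ∈ S.image (fun v => (e v).1), κ w (openOn (fiberIn e S w)) := by
  rw [← tileLaw_cells e κ _ _ fun w _ => measurableSet_openOn _]
  congr 1
  ext ω
  simp only [openOn, Set.mem_ofPred_eq, cell, mem_fiberIn]
  constructor
  · exact fun h w _ f hf => h _ hf
  · intro h v hv
    have := h (e v).1 (Finset.mem_image_of_mem _ hv) (e v).2 (by simpa using hv)
    simpa using this

theorem KWise.tileLaw {j : ℕ} {P : ℝ≥0∞} (e : V ≃ W × F) {κ : W → Measure (F → Bool)}
    (h : ∀ w, KWise j P (κ w)) : KWise j P (tileLaw e κ) := by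
  classical
  have := fun w => (h w).prob
  refine ⟨inferInstance, fun S hS => ?_⟩
  rw [tileLaw_openOn, card_eq_sum_fiberIn e S, ← Finset.prod_pow_eq_pow_sum]
  refine Finset.prod_congr rfl fun w hw => (h w).openOn_eq _ (le_trans ?_ hS)
  rw [card_eq_sum_fiberIn e S]
  exact Finset.single_le_sum (f := fun w => (fiberIn e S w).card) (fun _ _ => Nat.zero_le _) hw

end Tile

/-! ### Raising the order of independence by one -/

section Boost

/-- The law of a bit that is `true` with probability `P`. -/
noncomputable def coin (P : ℝ≥0∞) : Measure Bool :=
  P • Measure.dirac true + (1 - P) • Measure.dirac false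

theorem isProbabilityMeasure_coin {P : ℝ≥0∞} (hP : P ≤ 1) : IsProbabilityMeasure (coin P) :=
  ⟨by simp [coin, add_tsub_cancel_of_le hP]⟩

/-- Any law on the configurations of a finite cell can be mixed, with a small weight, with another
law so that the mixture has the same open probabilities as independent percolation. -/
theorem exists_complement {F : Type*} [Fintype F] {P : ℝ≥0∞} (h0 : 0 < P) (h1 : P < 1)
    (κ : Measure (F → Bool)) [IsProbabilityMeasure κ] :
    ∃ ρ : ℝ≥0∞, 0 < ρ ∧ ρ < 1 ∧ ∀ r ≤ ρ, ∃ κ' : Measure (F → Bool), IsProbabilityMeasure κ' ∧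
      ∀ S : Finset F, r * κ (openOn S) + (1 - r) * κ' (openOn S) = P ^ S.card := by
  classical
  have := isProbabilityMeasure_coin h1.le
  set μ : Measure (F → Bool) := Measure.infinitePi fun _ => coin P with hμ
  set m := min P (1 - P) with hm
  have hm0 : 0 < m := lt_min h0 (tsub_pos_of_lt h1)
  have hm1 : m < 1 := (min_le_left _ _).trans_lt h1
  have hμm : ∀ η, m ^ Fintype.card F ≤ μ {η} := fun η => by
    rw [hμ, Measure.infinitePi_singleton_of_fintype, ← Finset.card_univ, ← Finset.prod_const]
    refine Finset.prod_le_prod' fun f _ => ?_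
    cases η f <;> simp [coin, hm]
  have hμS : ∀ S : Finset F, μ (openOn S) = P ^ S.card := fun S => by
    have : openOn S = Set.pi (S : Set F) fun _ => {true} := by
      ext; simp [openOn, Set.mem_pi]
    rw [this, hμ, Measure.infinitePi_pi _ fun _ _ => measurableSet_singleton _]
    simp [coin]
  have hmp : m ^ (Fintype.card F + 1) < 1 := by
    refine lt_of_le_of_lt (pow_le_pow_of_le_one zero_le hm1.le (Nat.le_add_left 1 _)) ?_
    rwa [pow_one]
  -- The product law gives each configuration mass at least m ^ |F|, so it dominates r • κ, and the
  -- normalized remainder serves as κ'. The extra factor m keeps the bound below 1 when F is empty.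
  refine ⟨m ^ (Fintype.card F + 1), ENNReal.pow_pos hm0 _, hmp, fun r hr => ?_⟩
  have hr1 : r < 1 := hr.trans_lt hmp
  have hrt : r ≠ ∞ := (hr1.trans ENNReal.one_lt_top).ne
  have hle : r • κ ≤ μ := by
    rw [Measure.le_iff]
    intro s _
    rw [← Set.coe_toFinset s, ← sum_measure_singleton, ← sum_measure_singleton]
    refine Finset.sum_le_sum fun η _ => ?_
    calc (r • κ) {η} ≤ r * 1 := by
          rw [Measure.smul_apply, smul_eq_mul]
          gcongr
          exact prob_le_one
      _ ≤ m ^ Fintype.card F := by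
          rw [mul_one]
          exact hr.trans (pow_le_pow_of_le_one zero_le hm1.le (by simp))
      _ ≤ μ {η} := hμm η
  have : IsFiniteMeasure (r • κ) := ⟨by simp [hrt.lt_top]⟩
  have hsub := Measure.sub_add_cancel_of_le hle
  have h1r : 1 - r ≠ 0 := (tsub_pos_of_lt hr1).ne'
  have h1rt : 1 - r ≠ ∞ := (lt_of_le_of_lt tsub_le_self ENNReal.one_lt_top).ne
  have hform : ∀ s, r * κ s + (1 - r) * ((1 - r)⁻¹ • (μ - r • κ)) s = μ s := fun s => by
    conv_rhs => rw [← hsub]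
    rw [Measure.smul_apply, smul_eq_mul, ← mul_assoc, ENNReal.mul_inv_cancel h1r h1rt, one_mul,
      Measure.add_apply, Measure.smul_apply, smul_eq_mul, add_comm]
  refine ⟨(1 - r)⁻¹ • (μ - r • κ), ⟨?_⟩, fun S => by rw [hform, hμS]⟩
  have h2 := hform Set.univ
  rw [measure_univ (μ := κ), measure_univ (μ := μ), mul_one] at h2
  have h3 : (1 - r) * ((1 - r)⁻¹ • (μ - r • κ)) Set.univ = 1 - r :=
    ENNReal.eq_sub_of_add_eq hrt (by rw [add_comm, h2])
  rwa [ENNReal.mul_eq_left h1r h1rt] at h3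

open Classical in
/-- If each cell follows a `j`-wise independent law on a random set of cells of small one-point
density, and the complementary law elsewhere, then the resulting law is `(j + 1)`-wise
independent. -/
theorem exists_boost {V W F I : Type*} [Fintype I] [Nonempty I] (e : V ≃ W × F) {j : ℕ}
    {P ρ : ℝ≥0∞} {κ : Measure (F → Bool)} (hκ : KWise j P κ) (hρ1 : ρ < 1)
    (hρ : ∀ r ≤ ρ, ∃ κ' : Measure (F → Bool), IsProbabilityMeasure κ' ∧
      ∀ S : Finset F, r * κ (openOn S) + (1 - r) * κ' (openOn S) = P ^ S.card)
    (R : I → Set W)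
    (hR : ∀ w, ((Finset.univ.filter fun i => w ∈ R i).card : ℝ≥0∞) / Fintype.card I ≤ ρ) :
    ∃ κ' : I → W → Measure (F → Bool), (∀ i w, IsProbabilityMeasure (κ' i w)) ∧
      (∀ i w, w ∈ R i → κ' i w = κ) ∧
      KWise (j + 1) P ((Fintype.card I : ℝ≥0∞)⁻¹ • ∑ i, tileLaw e (κ' i)) := by
  choose κ₀ hκ₀ hκ₀' using fun w => hρ _ (hR w)
  have := hκ.prob
  set N : ℝ≥0∞ := (Fintype.card I : ℝ≥0∞) with hN
  have hN0 : N ≠ 0 := by simp [hN]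
  have hNt : N ≠ ∞ := by simp [hN]
  set κ' : I → W → Measure (F → Bool) := fun i w => if w ∈ R i then κ else κ₀ w with hκ'
  have hprob : ∀ i w, IsProbabilityMeasure (κ' i w) := fun i w => by
    simp only [hκ']; split_ifs <;> infer_instance
  -- Up to order j, κ and the mixture both have the product value; since 1 - r ≠ 0, the compensating
  -- law has it too. Hence the label is invisible at this order.
  have hsmall : ∀ i w (S : Finset F), S.card ≤ j → κ' i w (openOn S) = P ^ S.card := by
    intro i w S hS
    simp only [hκ']
    split_ifs
    · exact hκ.openOn_eq S hS
    · have h1 := hκ₀' w S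
      rw [hκ.openOn_eq S hS] at h1
      set r := ((Finset.univ.filter fun i => w ∈ R i).card : ℝ≥0∞) / N
      have hr1 : r < 1 := (hR w).trans_lt hρ1
      have h1r : 1 - r ≠ 0 := (tsub_pos_of_lt hr1).ne'
      have h1rt : 1 - r ≠ ∞ := (lt_of_le_of_lt tsub_le_self ENNReal.one_lt_top).ne
      have hPt : P ^ S.card ≠ ∞ := by
        rw [← hκ.openOn_eq S hS]; exact measure_ne_top _ _
      have h2 : r * P ^ S.card + (1 - r) * P ^ S.card = P ^ S.card := by
        rw [← add_mul, add_tsub_cancel_of_le hr1.le, one_mul]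
      have h3 := h1.trans h2.symm
      rw [ENNReal.add_right_inj (ENNReal.mul_ne_top (hr1.trans ENNReal.one_lt_top).ne hPt)] at h3
      exact (ENNReal.mul_right_inj h1r h1rt).1 h3
  have hmean : ∀ w (S : Finset F), N⁻¹ * ∑ i, κ' i w (openOn S) = P ^ S.card := by
    intro w S
    rw [← hκ₀' w S]
    have h1 : ∑ i, κ' i w (openOn S) =
        ((Finset.univ.filter fun i => w ∈ R i).card : ℝ≥0∞) * κ (openOn S) +
        ((Finset.univ.filter fun i => ¬ w ∈ R i).card : ℝ≥0∞) * κ₀ w (openOn S) := by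
      have : ∀ i, κ' i w (openOn S) = if w ∈ R i then κ (openOn S) else κ₀ w (openOn S) := by
        intro i; simp only [hκ']; split_ifs <;> rfl
      simp_rw [this, Finset.sum_ite, Finset.sum_const, nsmul_eq_mul]
    have h2 : ((Finset.univ.filter fun i => ¬ w ∈ R i).card : ℝ≥0∞) / N =
        1 - ((Finset.univ.filter fun i => w ∈ R i).card : ℝ≥0∞) / N := by
      refine ENNReal.eq_sub_of_add_eq ?_ ?_
      · exact ((hR w).trans_lt (hρ1.trans ENNReal.one_lt_top)).ne
      · rw [← ENNReal.add_div, ← Nat.cast_add, add_comm, Finset.card_filter_add_card_filter_not,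
          Finset.card_univ]
        exact ENNReal.div_self hN0 hNt
    rw [h1, mul_add, ← mul_assoc, ← mul_assoc, ← h2, ENNReal.div_eq_inv_mul,
      ENNReal.div_eq_inv_mul]
  refine ⟨κ', hprob, fun i w hw => by simp [hκ', hw], ⟨?_⟩, fun S hS => ?_⟩
  · simp only [Measure.smul_apply, Measure.finsetSum_apply, measure_univ, smul_eq_mul,
      Finset.sum_const, Finset.card_univ, nsmul_eq_mul, mul_one]
    exact ENNReal.inv_mul_cancel hN0 hNt
  · simp only [Measure.smul_apply, Measure.finsetSum_apply, smul_eq_mul]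
    simp_rw [tileLaw_openOn]
    -- Either every factor is independent of i by `hsmall`, or S has j + 1 points in a single cell
    -- and `hmean` applies.
    by_cases hb : ∀ w ∈ S.image (fun v => (e v).1), (fiberIn e S w).card ≤ j
    · have : ∀ i, ∏ w ∈ S.image (fun v => (e v).1), κ' i w (openOn (fiberIn e S w)) =
          P ^ S.card := fun i => by
        rw [card_eq_sum_fiberIn e S, ← Finset.prod_pow_eq_pow_sum]
        exact Finset.prod_congr rfl fun w hw => hsmall i w _ (hb w hw)
      simp_rw [this, Finset.sum_const, Finset.card_univ, nsmul_eq_mul, ← mul_assoc]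
      rw [ENNReal.inv_mul_cancel hN0 hNt, one_mul]
    · push Not at hb
      obtain ⟨w, hw, hj⟩ := hb
      have hsum := card_eq_sum_fiberIn e S
      rw [← Finset.add_sum_erase _ _ hw] at hsum
      have hz : ∀ w' ∈ (S.image (fun v => (e v).1)).erase w, (fiberIn e S w').card = 0 := by
        rw [← Finset.sum_eq_zero_iff]
        omega
      have hone : ∀ i, ∏ w ∈ S.image (fun v => (e v).1), κ' i w (openOn (fiberIn e S w)) =
          κ' i w (openOn (fiberIn e S w)) := fun i => by
        rw [← Finset.mul_prod_erase _ _ hw, Finset.prod_eq_one, mul_one]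
        intro w' hw'
        rw [hsmall i w' _ (by rw [hz w' hw']; exact Nat.zero_le _), hz w' hw', pow_zero]
      simp_rw [hone]
      rw [hmean]
      congr 1
      rw [Finset.sum_eq_zero hz] at hsum
      omega

theorem ae_smul_sum {Ω I : Type*} [MeasurableSpace Ω] [Fintype I] (c : ℝ≥0∞) {μ : I → Measure Ω}
    {p : I → Ω → Prop} (h : ∀ i, ∀ᵐ ω ∂μ i, p i ω) : ∀ᵐ ω ∂(c • ∑ i, μ i), ∃ i, p i ω := by
  rw [ae_iff, Measure.smul_apply, Measure.finsetSum_apply, smul_eq_mul, Finset.sum_eq_zero, mul_zero]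
  exact fun i _ => measure_mono_null (fun ω hω hp => hω ⟨i, hp⟩) (h i)

-- The label is not part of the configuration, so only the existence of a label with good cells can
-- be stated.
open Classical in
theorem ae_boost_cells {V W F I : Type*} [Countable W] [Fintype I] (e : V ≃ W × F)
    {κ : Measure (F → Bool)} {Ω : Set (F → Bool)} (hΩ : ∀ᵐ η ∂κ, η ∈ Ω) {R : I → Set W}
    {κ' : I → W → Measure (F → Bool)} [∀ i w, IsProbabilityMeasure (κ' i w)]
    (hκ' : ∀ i w, w ∈ R i → κ' i w = κ) (c : ℝ≥0∞) :
    ∀ᵐ ω ∂(c • ∑ i, tileLaw e (κ' i)), ∃ i, ∀ w ∈ R i, cell e ω w ∈ Ω := by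
  refine ae_smul_sum c fun i => ae_all_iff.2 fun w => ?_
  by_cases hw : w ∈ R i
  · have := tileLaw_ae_cell e (κ' i) w (p := (· ∈ Ω)) (by rwa [hκ' i w hw])
    filter_upwards [this] with ω hω _ using hω
  · exact Filter.Eventually.of_forall fun _ h => absurd h hw

theorem exists_natCast_div_le (K : ℕ) {ρ : ℝ≥0∞} (hρ : 0 < ρ) :
    ∃ h : ℕ, 0 < h ∧ (K : ℝ≥0∞) / h ≤ ρ := by
  obtain ⟨h, hh⟩ := ENNReal.exists_nat_mul_gt hρ.ne' (ENNReal.natCast_ne_top K)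
  refine ⟨h, ?_, ?_⟩
  · rcases Nat.eq_zero_or_pos h with rfl | h'
    · simp at hh
    · exact h'
  · exact ENNReal.div_le_of_le_mul (by rw [mul_comm]; exact hh.le)

end Boost

/-! ### Clusters as sets reachable along open paths -/

section Reach

variable {V : Type*} {G : SimpleGraph V} {ω : V → Bool}

/-- `v'` can be reached from `v` along a path of open vertices. -/
def Reach (G : SimpleGraph V) (ω : V → Bool) : V → V → Prop :=
  Relation.ReflTransGen fun x y => G.Adj x y ∧ ω x = true ∧ ω y = true

theorem Reach.symm {v v' : V} (h : Reach G ω v v') : Reach G ω v' v := by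
  induction h with
  | refl => exact .refl
  | tail _ hbc ih => exact .head ⟨hbc.1.symm, hbc.2.2, hbc.2.1⟩ ih

theorem Reach.of_reachable {v v' : {v | ω v = true}}
    (h : (G.induce {v | ω v = true}).Reachable v v') : Reach G ω v v' := by
  obtain ⟨p⟩ := h
  induction p with
  | nil => exact .refl
  | @cons u v _ h _ ih => exact .head ⟨h, u.2, v.2⟩ ih

theorem Reach.reachable {v v' : V} (h : Reach G ω v v') (hv : ω v = true) :
    ∃ hv' : ω v' = true, (G.induce {v | ω v = true}).Reachable ⟨v, hv⟩ ⟨v', hv'⟩ := by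
  induction h with
  | refl => exact ⟨hv, .refl _⟩
  | tail _ hbc ih =>
    obtain ⟨hb, h⟩ := ih
    refine ⟨hbc.2.2, h.trans (SimpleGraph.Adj.reachable ?_)⟩
    exact hbc.1

theorem hasInfiniteOpenCluster_iff :
    HasInfiniteOpenCluster G ω ↔ ∃ v, ω v = true ∧ {v' | Reach G ω v v'}.Infinite := by
  constructor
  · rintro ⟨C, hC⟩
    obtain ⟨⟨v, hv⟩, rfl⟩ := C.exists_rep
    refine ⟨v, hv, (hC.image Subtype.val_injective.injOn).mono ?_⟩
    rintro _ ⟨w, hw, rfl⟩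
    exact (Reach.of_reachable (SimpleGraph.ConnectedComponent.exact hw)).symm
  · rintro ⟨v, hv, h⟩
    refine ⟨(G.induce {v | ω v = true}).connectedComponentMk ⟨v, hv⟩, fun hfin => h ?_⟩
    refine (hfin.image Subtype.val).subset fun v' hv' => ?_
    obtain ⟨hv', hr⟩ := Reach.reachable hv' hv
    exact ⟨⟨v', hv'⟩, SimpleGraph.ConnectedComponent.sound hr.symm, rfl⟩

end Reach

/-! ### Cubes in the lattice -/

section Blocks

variable {d : ℕ} {V F : Type*}

/-- Split the points of `ℤ^d` into cubes of side `N`. -/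
def blockEquiv (d N : ℕ) [NeZero N] : (Fin d → ℤ) ≃ (Fin d → ℤ) × (Fin d → Fin N) :=
  (Equiv.piCongrRight fun _ => Int.divModEquiv N).trans (Equiv.arrowProdEquivProdArrow _ _ _)

theorem blockEquiv_fst (N : ℕ) [NeZero N] (z : Fin d → ℤ) (i : Fin d) :
    (blockEquiv d N z).1 i = z i / N := rfl

theorem blockEquiv_eq (N : ℕ) [NeZero N] (z : Fin d → ℤ) (i : Fin d) :
    z i / N * N + ((blockEquiv d N z).2 i : ℕ) = z i :=
  congrFun ((blockEquiv d N).symm_apply_apply z) i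

/-- Group the cells into cubes of side `N`. -/
def coarsen (e : V ≃ (Fin d → ℤ) × F) (N : ℕ) [NeZero N] :
    V ≃ (Fin d → ℤ) × ((Fin d → Fin N) × F) :=
  (e.trans ((blockEquiv d N).prodCongr (Equiv.refl F))).trans (Equiv.prodAssoc _ _ _)

theorem coarsen_fst (e : V ≃ (Fin d → ℤ) × F) (N : ℕ) [NeZero N] (v : V) (i : Fin d) :
    (coarsen e N v).1 i = (e v).1 i / N := rfl

theorem cell_coarsen (e : V ≃ (Fin d → ℤ) × F) (N : ℕ) [NeZero N] (ω : V → Bool)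
    (z : Fin d → ℤ) :
    cell (Equiv.refl _) (cell (coarsen e N) ω (blockEquiv d N z).1) (blockEquiv d N z).2 =
      cell e ω z := by
  ext f
  simp [cell, coarsen]

theorem Int.ediv_eq_of_mul_le {x q N : ℤ} (h1 : q * N ≤ x) (h2 : x < q * N + N) : x / N = q := by
  have hN : 0 < N := by linarith
  refine le_antisymm (Int.le_of_lt_add_one ?_) ((Int.le_ediv_iff_mul_le hN).2 h1)
  rw [Int.ediv_lt_iff_lt_mul hN]
  linarith

theorem Int.abs_ediv_sub_ediv_le {x y N : ℤ} (hN : 0 < N) (h : |x - y| ≤ 1) :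
    |x / N - y / N| ≤ 1 := by
  have key : ∀ a b : ℤ, a ≤ b + 1 → a / N ≤ b / N + 1 := fun a b hab => by
    calc a / N ≤ (b + 1 * N) / N := Int.ediv_le_ediv hN (by linarith)
      _ = b / N + 1 := Int.add_mul_ediv_right _ _ hN.ne'
  rw [abs_le] at h ⊢
  have := key x y (by linarith)
  have := key y x (by linarith)
  constructor <;> linarith

end Blocks

/-! ### No percolation on the lattice -/

section Confining

variable {d : ℕ} {V F : Type*}

/-- An open path which starts in a cell, all of whose neighbours have their configuration in `Ω`,
cannot leave these neighbours. -/
def Confines (G : SimpleGraph V) (e : V ≃ (Fin d → ℤ) × F) (Ω : Set (F → Bool)) : Prop :=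
  ∀ (ω : V → Bool) (z : Fin d → ℤ), (∀ z', (∀ i, |z' i - z i| ≤ 1) → cell e ω z' ∈ Ω) →
    ∀ v v', (e v).1 = z → Reach G ω v v' → ∀ i, |(e v').1 i - z i| ≤ 1

/-- The thickened hyperplanes in the cube of side `3 n` with label `a`, when each position carries
one label for each neighbouring cube. -/
def wall {h n : ℕ} (code : Fin n ≃ ((Fin d → Fin 3) → Fin h)) (a : Fin h) :
    Set (Fin d → Fin (n * 3)) :=
  {y | ∃ i δ, code (y i).divNat δ = a}

/-- A position codes one label per direction, so a single t codes the labels of all 3 ^ d cubes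
around U. At position t the walls of these cubes fit together into the boundary of a box of side 2 N
around U, three cells thick. By the confining property of the small cells, an open path cannot get
from U to the middle layer. -/
theorem Confines.coarsen {G : SimpleGraph V} {e : V ≃ (Fin d → ℤ) × F} {Ω : Set (F → Bool)}
    (hΩ : Confines G e Ω) (hG : ∀ x y, G.Adj x y → ∀ i, |(e x).1 i - (e y).1 i| ≤ 1) {h n : ℕ}
    (code : Fin n ≃ ((Fin d → Fin 3) → Fin h)) [NeZero (n * 3)] :
    Confines G (coarsen e (n * 3))
      {η | ∃ a, ∀ y ∈ wall code a, cell (Equiv.refl _) η y ∈ Ω} := by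
  intro ω U hU v v' hv hr
  obtain ⟨a₀, -⟩ := hU U (by simp)
  have : Nonempty (Fin h) := ⟨a₀⟩
  choose! a ha using hU
  obtain ⟨t, ht⟩ := code.surjective fun δ => a fun i => U i + ((δ i : ℕ) : ℤ) - 1
  have htn := t.2
  set N : ℤ := ((n * 3 : ℕ) : ℤ) with hN
  have hNn : N = n * 3 := by rw [hN]; push_cast; ring
  have hN0 : 0 < N := by rw [hNn]; omega
  have key : ∀ z : Fin d → ℤ, (∀ l, U l * N - N ≤ z l ∧ z l < U l * N + 2 * N) →
      (∃ i, (U i * N - N + 3 * t ≤ z i ∧ z i ≤ U i * N - N + 3 * t + 2) ∨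
        (U i * N + N + 3 * t ≤ z i ∧ z i ≤ U i * N + N + 3 * t + 2)) → cell e ω z ∈ Ω := by
    rintro z hz ⟨i, hi⟩
    rw [← cell_coarsen e (n * 3) ω z]
    have hq : ∀ l, U l - 1 ≤ z l / N ∧ z l / N < U l + 2 := fun l => by
      rw [Int.le_ediv_iff_mul_le hN0, Int.ediv_lt_iff_lt_mul hN0]
      constructor <;> linarith [(hz l).1, (hz l).2]
    refine ha _ (fun l => ?_) _ ⟨i, fun l => ⟨(z l / N - U l + 1).toNat, ?_⟩, ?_⟩
    · have := hq l
      rw [blockEquiv_fst, ← hN, abs_le]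
      omega
    · have := hq l
      omega
    · have hy := blockEquiv_eq (n * 3) z i
      rw [← hN] at hy
      have hdiv : ((blockEquiv d (n * 3) z).2 i).divNat = t := by
        rw [Fin.ext_iff, Fin.coe_divNat]
        rcases hi with hi | hi
        · have h1 : z i / N = U i - 1 :=
            Int.ediv_eq_of_mul_le (by linarith [hi.1]) (by rw [hNn] at *; linarith [hi.2])
          rw [h1, sub_mul, one_mul] at hy
          omega
        · have h1 : z i / N = U i + 1 :=
            Int.ediv_eq_of_mul_le (by linarith [hi.1]) (by rw [hNn] at *; linarith [hi.2])
          rw [h1, add_mul, one_mul] at hy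
          omega
      rw [hdiv, ht]
      refine congrArg a (funext fun l => ?_)
      have := hq l
      rw [blockEquiv_fst, ← hN]
      simp only
      omega
  have hv1 : ∀ l, U l * N ≤ (e v).1 l ∧ (e v).1 l < U l * N + N := fun l => by
    have h1 : (e v).1 l / N = U l := congrFun hv l
    have h2 := Int.emod_add_mul_ediv ((e v).1 l) N
    have h3 := Int.emod_nonneg ((e v).1 l) hN0.ne'
    have h4 := Int.emod_lt_of_pos ((e v).1 l) hN0
    rw [h1, mul_comm] at h2
    omega
  -- The bounds are the middle layers of the walls. Steps change each cell coordinate by at most 1,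
  -- so a path leaving the box first hits such a layer.
  have inside : ∀ l, U l * N - N + 3 * t + 1 < (e v').1 l ∧
      (e v').1 l < U l * N + N + 3 * t + 1 := by
    induction hr with
    | refl => intro l; have := hv1 l; omega
    | @tail b c hab hbc ih =>
      by_contra hcon
      push Not at hcon
      obtain ⟨i, hi⟩ := hcon
      have hstep : ∀ l, |(e b).1 l - (e c).1 l| ≤ 1 := hG b c hbc.1
      have hc : ∀ l, U l * N - N + 3 * t + 1 ≤ (e c).1 l ∧
          (e c).1 l ≤ U l * N + N + 3 * t + 1 := fun l => by
        have := ih l; have := abs_le.1 (hstep l); omega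
      -- All neighbours of the cell of c are in the thick wall, so the reversed path from c stays
      -- within distance 1 of that cell; but v lies at distance at least 2 in direction i.
      have hback := hΩ ω (e c).1 (fun z hz => key z (fun l => ?_) ⟨i, ?_⟩) c v rfl
        (Reach.symm (hab.tail hbc)) i
      · have := hv1 i; have := hc i; have := abs_le.1 hback
        by_cases h1 : U i * N - N + 3 * t + 1 < (e c).1 i
        · have := hi h1; omega
        · omega
      · have := hc l; have := abs_le.1 (hz l); omega
      · have := hc i; have := abs_le.1 (hz i)
        by_cases h1 : U i * N - N + 3 * t + 1 < (e c).1 i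
        · have := hi h1; right; omega
        · left; omega
  intro l
  rw [coarsen_fst, ← hN, abs_le]
  have := inside l
  have h1 : U l - 1 ≤ (e v').1 l / N := by
    rw [Int.le_ediv_iff_mul_le hN0]; linarith [this.1]
  have h2 : (e v').1 l / N < U l + 2 := by
    rw [Int.ediv_lt_iff_lt_mul hN0]; linarith [this.2]
  omega

/-- The bound does not involve h, so many labels make walls of arbitrarily small density. -/
theorem card_wall_le {h n : ℕ} (code : Fin n ≃ ((Fin d → Fin 3) → Fin h))
    (y : Fin d → Fin (n * 3)) [DecidablePred fun a => y ∈ wall code a] :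
    (Finset.univ.filter fun a => y ∈ wall code a).card ≤ d * 3 ^ d := by
  classical
  calc (Finset.univ.filter fun a => y ∈ wall code a).card
      ≤ ((Finset.univ : Finset (Fin d × (Fin d → Fin 3))).image
          fun q => code (y q.1).divNat q.2).card := by
        refine Finset.card_le_card fun a ha => ?_
        obtain ⟨i, δ, h⟩ := (Finset.mem_filter.1 ha).2
        exact Finset.mem_image.2 ⟨(i, δ), Finset.mem_univ _, h⟩
    _ ≤ d * 3 ^ d := Finset.card_image_le.trans (by simp)

theorem exists_confines {G : SimpleGraph (Fin d → ℤ)}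
    (hG : ∀ x y, G.Adj x y → ∀ i, |x i - y i| ≤ 1) {P : ℝ≥0∞} (h0 : 0 < P) (h1 : P < 1) (j : ℕ) :
    ∃ (F : Type) (_ : Fintype F) (e : (Fin d → ℤ) ≃ (Fin d → ℤ) × F) (Ω : Set (F → Bool))
      (κ : Measure (F → Bool)), (∀ x y, G.Adj x y → ∀ i, |(e x).1 i - (e y).1 i| ≤ 1) ∧
      Confines G e Ω ∧ KWise j P κ ∧ ∀ᵐ η ∂κ, η ∈ Ω := by
  induction j with
  | zero =>
    -- With single vertices as cells and everything closed, no path can leave its starting vertex.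
    refine ⟨Unit, inferInstance, (Equiv.prodPUnit _).symm, {fun _ => false},
      Measure.dirac fun _ => false, hG, ?_, ⟨inferInstance, ?_⟩, ?_⟩
    · intro ω z hz v v' hv hr
      have hv0 : ω v = false := congrFun (hz z (by simp)) () ▸ by subst hv; rfl
      have : v = v' := by
        induction hr using Relation.ReflTransGen.head_induction_on with
        | refl => rfl
        | head h _ _ => simp [hv0] at h
      subst this hv
      simp
    · intro S hS
      obtain rfl : S = ∅ := by simpa using hS
      simp [openOn]
    · rw [ae_dirac_eq]; simp
  | succ j ih =>
    obtain ⟨F, _, e, Ω, κ, hLip, hConf, hκ, hΩ⟩ := ih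
    have := hκ.prob
    obtain ⟨ρ, hρ0, hρ1, hρ⟩ := exists_complement h0 h1 κ
    obtain ⟨h, hh0, hh⟩ := exists_natCast_div_le (d * 3 ^ d) hρ0
    have : Nonempty (Fin h) := ⟨⟨0, hh0⟩⟩
    set n := Fintype.card ((Fin d → Fin 3) → Fin h)
    have hn : 0 < n := Fintype.card_pos
    have : NeZero (n * 3) := ⟨by omega⟩
    let code : Fin n ≃ ((Fin d → Fin 3) → Fin h) := (Fintype.equivFin _).symm
    classical
    obtain ⟨κ', hprob, hκ', hK⟩ := exists_boost (Equiv.refl ((Fin d → Fin (n * 3)) × F)) hκ hρ1 hρ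
      (wall code) (fun y => le_trans (by
        rw [Fintype.card_fin]
        gcongr
        exact card_wall_le code y) hh)
    refine ⟨(Fin d → Fin (n * 3)) × F, inferInstance, _root_.coarsen e (n * 3), _, _, ?_,
      hConf.coarsen hLip code, hK, ae_boost_cells _ hΩ hκ' _⟩
    intro x y hxy i
    exact Int.abs_ediv_sub_ediv_le (by positivity) (hLip x y hxy i)

theorem exists_no_infinite_cluster_lattice {P : ℝ≥0∞} (h0 : 0 < P) (h1 : P < 1) (j : ℕ) :
    ∃ Q : Measure ((Fin d → ℤ) → Bool), KWise j P Q ∧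
      ∀ᵐ ω ∂Q, ¬ HasInfiniteOpenCluster (latticeGraph d) ω := by
  obtain ⟨F, _, e, Ω, κ, -, hConf, hκ, hΩ⟩ := exists_confines (G := latticeGraph d)
    (fun x y (hxy : ∑ i, |x i - y i| = 1) i => hxy ▸ Finset.single_le_sum
      (f := fun i => |x i - y i|) (fun _ _ => abs_nonneg _) (Finset.mem_univ i)) h0 h1 j
  have := hκ.prob
  refine ⟨tileLaw e fun _ => κ, KWise.tileLaw e fun _ => hκ, ?_⟩
  have hall : ∀ᵐ ω ∂tileLaw e fun _ => κ, ∀ z, cell e ω z ∈ Ω :=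
    ae_all_iff.2 fun z => tileLaw_ae_cell e _ z hΩ
  filter_upwards [hall] with ω hω
  rw [hasInfiniteOpenCluster_iff]
  rintro ⟨v, -, hv⟩
  refine hv ((((Set.finite_Icc ((e v).1 - 1) ((e v).1 + 1)).prod
    (Set.finite_univ (α := F))).preimage e.injective.injOn).subset fun v' hv' => ?_)
  have := hConf ω _ (fun z' _ => hω z') v v' rfl hv'
  refine ⟨⟨fun i => ?_, fun i => ?_⟩, trivial⟩ <;> have := abs_le.1 (this i) <;>
    simp only [Pi.sub_apply, Pi.add_apply, Pi.one_apply] <;> omega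

end Confining

/-! ### Percolation on the lattice -/

section Linking

variable {d : ℕ} {V F : Type*}

/-- The representative vertex of a cell, when `b` selects one from the configuration. -/
def rep (e : V ≃ (Fin d → ℤ) × F) (b : (F → Bool) → F) (ω : V → Bool) (z : Fin d → ℤ) : V :=
  e.symm (z, b (cell e ω z))

/-- The representatives of cells which are neighbours in a direction of `D` are joined by an open
path if both cells have their configuration in `Ω`. -/
def Links (G : SimpleGraph V) (D : Set (Fin d)) (e : V ≃ (Fin d → ℤ) × F) (Ω : Set (F → Bool))
    (b : (F → Bool) → F) : Prop :=
  ∀ (ω : V → Bool), ∀ i ∈ D, ∀ z, cell e ω z ∈ Ω → cell e ω (Function.update z i (z i + 1)) ∈ Ω →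
    Reach G ω (rep e b ω z) (rep e b ω (Function.update z i (z i + 1)))

variable {G : SimpleGraph V} {D : Set (Fin d)} {e : V ≃ (Fin d → ℤ) × F} {Ω : Set (F → Bool)}
  {b : (F → Bool) → F}

theorem Links.line_of_le (hΩ : Links G D e Ω b) {ω : V → Bool} {i : Fin d} (hi : i ∈ D)
    (z : Fin d → ℤ) {x y : ℤ} (hxy : x ≤ y)
    (h : ∀ t, x ≤ t → t ≤ y → cell e ω (Function.update z i t) ∈ Ω) :
    Reach G ω (rep e b ω (Function.update z i x)) (rep e b ω (Function.update z i y)) := by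
  induction y, hxy using Int.leInduction with
  | base => exact .refl
  | succ y hxy ih =>
    refine (ih fun t h1 h2 => h t h1 (by omega)).trans ?_
    have h1 := hΩ ω i hi (Function.update z i y) (h y hxy (by omega))
    simp only [Function.update_self, Function.update_idem] at h1
    exact h1 (h (y + 1) (by omega) le_rfl)

theorem Links.line (hΩ : Links G D e Ω b) {ω : V → Bool} {i : Fin d} (hi : i ∈ D)
    (z : Fin d → ℤ) (x y : ℤ)
    (h : ∀ t, min x y ≤ t → t ≤ max x y → cell e ω (Function.update z i t) ∈ Ω) :
    Reach G ω (rep e b ω (Function.update z i x)) (rep e b ω (Function.update z i y)) := by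
  rcases le_total x y with hxy | hxy
  · rw [min_eq_left hxy, max_eq_right hxy] at h
    exact hΩ.line_of_le hi z hxy h
  · rw [min_eq_right hxy, max_eq_left hxy] at h
    exact (hΩ.line_of_le hi z hxy h).symm

/-- The hyperplanes with label `a` in the directions of `D`, when each position carries two
labels. -/
def grid {h n : ℕ} (D : Set (Fin d)) (code : Fin n ≃ Fin h × Fin h) (a : Fin h) :
    Set (Fin d → Fin n) :=
  {y | ∃ i ∈ D, (code (y i)).1 = a ∨ (code (y i)).2 = a}

open Classical in
/-- A point of the grid with label `a`. -/
noncomputable def gridPoint {h n : ℕ} [NeZero n] (D : Set (Fin d)) (code : Fin n ≃ Fin h × Fin h)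
    (a : Fin h) : Fin d → Fin n :=
  fun l => if l ∈ D then code.symm (a, a) else 0

/-- Let neighbouring cubes have labels a and a'. The position coding (a, a') carries both labels, so
its hyperplane orthogonal to j belongs to both grids and bridges the cubes in direction i. The
representatives sit at the diagonal codes (a, a) and (a', a'), and a three-leg path in the two
directions of D joins them. -/
theorem Links.coarsen (hΩ : Links G D e Ω b) (hD : ∀ i ∈ D, ∃ j, j ≠ i ∧ D = {i, j}) {h n : ℕ}
    [NeZero n] (code : Fin n ≃ Fin h × Fin h) (s : ((Fin d → Fin n) × F → Bool) → Fin h) :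
    Links G D (coarsen e n)
      {η | ∀ y ∈ grid D code (s η), cell (Equiv.refl _) η y ∈ Ω}
      fun η => (gridPoint D code (s η), b (cell (Equiv.refl _) η (gridPoint D code (s η)))) := by
  intro ω i hi U hU hU'
  obtain ⟨j, hji, hDij⟩ := hD i hi
  have hj : j ∈ D := by rw [hDij]; exact Or.inr rfl
  set U' := Function.update U i (U i + 1) with hU'def
  set a := s (cell (_root_.coarsen e n) ω U) with ha
  set a' := s (cell (_root_.coarsen e n) ω U') with ha'
  have hn0 : 0 < (n : ℤ) := by exact_mod_cast Nat.pos_of_neZero n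
  have hrep : ∀ W, rep (_root_.coarsen e n) (fun η => (gridPoint D code (s η),
      b (cell (Equiv.refl _) η (gridPoint D code (s η))))) ω W =
      rep e b ω ((blockEquiv d n).symm (W, gridPoint D code (s (cell (_root_.coarsen e n) ω W)))) :=
    fun W => rfl
  rw [hrep, hrep, ← ha, ← ha']
  have good : ∀ W, cell (_root_.coarsen e n) ω W ∈
      {η | ∀ y ∈ grid D code (s η), cell (Equiv.refl _) η y ∈ Ω} →
      ∀ z : Fin d → ℤ, (∀ l, W l * n ≤ z l ∧ z l < W l * n + n) →
      (∃ l ∈ D, ∃ τ : Fin n, z l = W l * n + (τ : ℕ) ∧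
        ((code τ).1 = s (cell (_root_.coarsen e n) ω W) ∨
          (code τ).2 = s (cell (_root_.coarsen e n) ω W))) → cell e ω z ∈ Ω := by
    rintro W hW z hz ⟨l, hl, τ, hτ, hc⟩
    have hdiv : ∀ l, z l / n = W l := fun l => Int.ediv_eq_of_mul_le (hz l).1 (hz l).2
    have h1 : (blockEquiv d n z).1 = W := funext hdiv
    have h2 : (blockEquiv d n z).2 l = τ := by
      have := blockEquiv_eq n z l
      rw [hdiv, hτ] at this
      ext
      omega
    rw [← cell_coarsen e n ω z, h1]
    exact hW _ ⟨l, hl, by rwa [h2]⟩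
  obtain ⟨ta, hta⟩ : ∃ τ, τ = code.symm (a, a) := ⟨_, rfl⟩
  obtain ⟨ta', hta'⟩ : ∃ τ, τ = code.symm (a', a') := ⟨_, rfl⟩
  obtain ⟨t, ht⟩ : ∃ τ, τ = code.symm (a, a') := ⟨_, rfl⟩
  have hp : ∀ W α l, (blockEquiv d n).symm (W, gridPoint D code α) l =
      W l * n + (gridPoint D code α l : ℕ) := fun _ _ _ => rfl
  have hU'i : U' i = U i + 1 := by simp [hU'def]
  have hU'l : ∀ l, l ≠ i → U' l = U l := fun l hl => by simp [hU'def, hl]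
  have hmul : (U i + 1) * n = U i * n + n := by ring
  obtain ⟨p, hpdef⟩ : ∃ p, p = (blockEquiv d n).symm (U, gridPoint D code a) := ⟨_, rfl⟩
  obtain ⟨q, hqdef⟩ : ∃ q, q = (blockEquiv d n).symm (U', gridPoint D code a') := ⟨_, rfl⟩
  have hpl : ∀ l, U l * n ≤ p l ∧ p l < U l * n + n := fun l => by
    have := (gridPoint D code a l).2
    rw [hpdef, hp]; omega
  have hpD : ∀ l ∈ D, p l = U l * n + (ta : ℕ) := fun l hl => by
    rw [hpdef, hp, gridPoint, if_pos hl, hta]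
  have hqD : ∀ l ∈ D, q l = U' l * n + (ta' : ℕ) := fun l hl => by
    rw [hqdef, hp, gridPoint, if_pos hl, hta']
  -- Moves in the directions i and j suffice because the grid points have position 0 in all other
  -- directions.
  have hpq : Function.update (Function.update (Function.update p j (U j * n + (t : ℕ))) i (q i))
      j (q j) = q := by
    ext l
    by_cases hlj : l = j
    · subst hlj; simp
    by_cases hli : l = i
    · subst hli; simp [hlj]
    · have hlD : l ∉ D := by rw [hDij]; rintro (h | h) <;> contradiction
      simp only [Function.update_of_ne hlj, Function.update_of_ne hli]
      rw [hpdef, hqdef, hp, hp, hU'l l hli, gridPoint, gridPoint, if_neg hlD, if_neg hlD]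
  have htalt := ta.2
  have htalt' := ta'.2
  have htlt := t.2
  have hUj : U' j = U j := hU'l j hji
  have hpj := hpD j hj
  have hpi := hpD i hi
  have hqj := hqD j hj
  have hqi := hqD i hi
  rw [hUj] at hqj
  rw [hU'i, hmul] at hqi
  rw [← hpdef, ← hqdef, ← hpq]
  -- First leg: direction j, inside the hyperplane of U at position (a, a) in direction i.
  have step1 := hΩ.line (ω := ω) hj p (p j) (U j * n + (t : ℕ)) fun x hx1 hx2 => by
    refine good U hU _ (fun l => ?_) ⟨i, hi, ta, ?_, Or.inl (by simp [hta, ha])⟩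
    · by_cases hl : l = j
      · subst hl; rw [Function.update_self]; omega
      · rw [Function.update_of_ne hl]; exact hpl l
    · rw [Function.update_of_ne hji.symm, hpi]
  rw [Function.update_eq_self] at step1
  -- Second leg: across the common face along the shared hyperplane, good through a in U and through
  -- a' in U'.
  have step2 := hΩ.line (ω := ω) hi (Function.update p j (U j * n + (t : ℕ))) (p i) (q i)
    fun x hx1 hx2 => by
      by_cases hx : x < U i * n + n
      · refine good U hU _ (fun l => ?_) ⟨j, hj, t, ?_, Or.inl (by simp [ht, ha])⟩
        · by_cases hl : l = i
          · subst hl; rw [Function.update_self]; omega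
          rw [Function.update_of_ne hl]
          by_cases hl' : l = j
          · subst hl'; rw [Function.update_self]; omega
          · rw [Function.update_of_ne hl']; exact hpl l
        · rw [Function.update_of_ne hji, Function.update_self]
      · refine good U' hU' _ (fun l => ?_) ⟨j, hj, t, ?_, Or.inr (by simp [ht, ha'])⟩
        · by_cases hl : l = i
          · subst hl; rw [Function.update_self, hU'i, hmul]; omega
          rw [Function.update_of_ne hl, hU'l l hl]
          by_cases hl' : l = j
          · subst hl'; rw [Function.update_self]; omega
          · rw [Function.update_of_ne hl']; exact hpl l
        · rw [Function.update_of_ne hji, Function.update_self, hUj]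
  have hself : Function.update (Function.update p j (U j * n + (t : ℕ))) i (p i) =
      Function.update p j (U j * n + (t : ℕ)) := by
    rw [Function.update_eq_self_iff, Function.update_of_ne hji.symm]
  rw [hself] at step2
  -- Third leg: direction j again, in the hyperplane of U' at position (a', a').
  have step3 := hΩ.line (ω := ω) hj
    (Function.update (Function.update p j (U j * n + (t : ℕ))) i (q i)) (U j * n + (t : ℕ)) (q j)
    fun x hx1 hx2 => by
      refine good U' hU' _ (fun l => ?_) ⟨i, hi, ta', ?_, Or.inl (by simp [hta', ha'])⟩
      · by_cases hl' : l = j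
        · subst hl'; rw [Function.update_self, hUj]; omega
        rw [Function.update_of_ne hl']
        by_cases hl : l = i
        · subst hl; rw [Function.update_self, hU'i, hmul]; omega
        rw [Function.update_of_ne hl, Function.update_of_ne hl', hU'l l hl]
        exact hpl l
      · rw [Function.update_of_ne hji.symm, Function.update_self, hU'i, hmul, hqi]
  have hself' : Function.update (Function.update (Function.update p j (U j * n + (t : ℕ))) i (q i))
      j (U j * n + (t : ℕ)) = Function.update (Function.update p j (U j * n + (t : ℕ))) i (q i) := by
    rw [Function.update_eq_self_iff, Function.update_of_ne hji, Function.update_self]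
  rw [hself'] at step3
  exact (step1.trans step2).trans step3

theorem card_grid_le {h n : ℕ} (D : Set (Fin d)) (code : Fin n ≃ Fin h × Fin h)
    (y : Fin d → Fin n) [DecidablePred fun a => y ∈ grid D code a] :
    (Finset.univ.filter fun a => y ∈ grid D code a).card ≤ d * 2 := by
  classical
  calc (Finset.univ.filter fun a => y ∈ grid D code a).card
      ≤ ((Finset.univ : Finset (Fin d × Bool)).image
          fun q => bif q.2 then (code (y q.1)).1 else (code (y q.1)).2).card := by
        refine Finset.card_le_card fun a ha => ?_
        obtain ⟨i, -, h | h⟩ := (Finset.mem_filter.1 ha).2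
        · exact Finset.mem_image.2 ⟨(i, true), Finset.mem_univ _, h⟩
        · exact Finset.mem_image.2 ⟨(i, false), Finset.mem_univ _, h⟩
    _ ≤ d * 2 := Finset.card_image_le.trans (by simp)

theorem exists_links {G : SimpleGraph (Fin d → ℤ)} {D : Set (Fin d)}
    (hD : ∀ i ∈ D, ∃ j, j ≠ i ∧ D = {i, j})
    (hG : ∀ z, ∀ i ∈ D, G.Adj z (Function.update z i (z i + 1))) {P : ℝ≥0∞} (h0 : 0 < P)
    (h1 : P < 1) (j : ℕ) :
    ∃ (F : Type) (_ : Fintype F) (e : (Fin d → ℤ) ≃ (Fin d → ℤ) × F) (Ω : Set (F → Bool))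
      (b : (F → Bool) → F) (κ : Measure (F → Bool)),
      Links G D e Ω b ∧ KWise j P κ ∧ ∀ᵐ η ∂κ, η ∈ Ω := by
  induction j with
  | zero =>
    refine ⟨Unit, inferInstance, (Equiv.prodPUnit _).symm, {fun _ => true}, fun _ => (),
      Measure.dirac fun _ => true, ?_, ⟨inferInstance, ?_⟩, ?_⟩
    · intro ω i hi z h1 h2
      exact .single ⟨hG z i hi, congrFun h1 (), congrFun h2 ()⟩
    · intro S hS
      obtain rfl : S = ∅ := by simpa using hS
      simp [openOn]
    · rw [ae_dirac_eq]; simp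
  | succ j ih =>
    obtain ⟨F, _, e, Ω, b, κ, hL, hκ, hΩ⟩ := ih
    have := hκ.prob
    obtain ⟨ρ, hρ0, hρ1, hρ⟩ := exists_complement h0 h1 κ
    obtain ⟨h, hh0, hh⟩ := exists_natCast_div_le (d * 2) hρ0
    have : Nonempty (Fin h) := ⟨⟨0, hh0⟩⟩
    set n := Fintype.card (Fin h × Fin h)
    have : NeZero n := ⟨Fintype.card_ne_zero⟩
    let code : Fin n ≃ Fin h × Fin h := (Fintype.equivFin _).symm
    classical
    obtain ⟨κ', hprob, hκ', hK⟩ := exists_boost (Equiv.refl ((Fin d → Fin n) × F)) hκ hρ1 hρ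
      (grid D code) (fun y => le_trans (by
        rw [Fintype.card_fin]
        gcongr
        exact card_grid_le D code y) hh)
    have hae := ae_boost_cells (Equiv.refl _) hΩ hκ' (Fintype.card (Fin h) : ℝ≥0∞)⁻¹
    -- The representative must be a function of the configuration, so some label with a good grid is
    -- chosen from η.
    let s : ((Fin d → Fin n) × F → Bool) → Fin h := fun η =>
      Classical.epsilon fun a => ∀ y ∈ grid D code a, cell (Equiv.refl _) η y ∈ Ω
    refine ⟨(Fin d → Fin n) × F, inferInstance, _root_.coarsen e n, _, _, _,
      hL.coarsen hD code s, hK, ?_⟩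
    filter_upwards [hae] with η hη
    exact Classical.epsilon_spec hη

theorem exists_infinite_cluster_lattice (hd : 2 ≤ d) {P : ℝ≥0∞} (h0 : 0 < P) (h1 : P < 1)
    (j : ℕ) : ∃ Q : Measure ((Fin d → ℤ) → Bool), KWise j P Q ∧
      ∀ᵐ ω ∂Q, HasInfiniteOpenCluster (latticeGraph d) ω := by
  obtain ⟨F, _, e, Ω, b, κ, hL, hκ, hΩ⟩ := exists_links (G := latticeGraph d)
    (D := {⟨0, by omega⟩, ⟨1, by omega⟩}) (by
      rintro i (rfl | rfl)
      · exact ⟨⟨1, by omega⟩, Fin.ne_of_val_ne one_ne_zero, rfl⟩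
      · exact ⟨⟨0, by omega⟩, Fin.ne_of_val_ne zero_ne_one, Set.pair_comm _ _⟩) (by
      intro z i _
      change ∑ l, |z l - Function.update z i (z i + 1) l| = 1
      rw [Finset.sum_eq_single i]
      · simp
      · intro l _ hl; simp [hl]
      · simp) h0 h1 j
  have := hκ.prob
  refine ⟨tileLaw e fun _ => κ, KWise.tileLaw e fun _ => hκ, ?_⟩
  have hall : ∀ᵐ ω ∂tileLaw e fun _ => κ, ∀ z, cell e ω z ∈ Ω :=
    ae_all_iff.2 fun z => tileLaw_ae_cell e _ z hΩ
  filter_upwards [hall] with ω hω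
  rw [hasInfiniteOpenCluster_iff]
  set i : Fin d := ⟨0, by omega⟩
  let f : ℕ → Fin d → ℤ := fun n => Function.update 0 i n
  have hreach : ∀ n, Reach (latticeGraph d) ω (rep e b ω (f 0)) (rep e b ω (f n)) := fun n =>
    hL.line (i := i) (Or.inl rfl) 0 _ _ fun _ _ _ => hω _
  have hinj : Function.Injective fun n => rep e b ω (f n) := fun m n hmn => by
    have := congrFun (Prod.ext_iff.1 (e.symm.injective hmn)).1 i
    simpa [f] using this
  refine ⟨rep e b ω (f 0), ?_, Set.infinite_of_injective_forall_mem hinj hreach⟩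
  -- A path to a different vertex has a first step, so its starting point is open.
  rcases Relation.ReflTransGen.cases_head (hreach 1) with h | ⟨_, h, _⟩
  · exact absurd (hinj h) (by simp)
  · exact h.2.1

end Linking

/-! ### No percolation on the tree -/

section Tree

variable {d : ℕ}

/-- The words of length less than `s`. -/
abbrev Words (d s : ℕ) : Type := {u : List (Fin d) // u.length < s}

noncomputable instance (s : ℕ) : Fintype (Words d s) :=
  have : Finite (Words d s) := (List.finite_length_lt (Fin d) s).to_subtype
  Fintype.ofFinite _

/-- Split the tree into blocks of height `s`: a word is a root, of length divisible by `s`,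
followed by a word of length less than `s`. -/
def treeEquiv (d : ℕ) {s : ℕ} (hs : 0 < s) :
    List (Fin d) ≃ {x : List (Fin d) // s ∣ x.length} × Words d s where
  toFun v := (⟨v.drop (v.length % s), by
      rw [List.length_drop]; exact Nat.dvd_sub_mod _⟩,
    ⟨v.take (v.length % s), by
      rw [List.length_take]; exact (min_le_left _ _).trans_lt (Nat.mod_lt _ hs)⟩)
  invFun q := q.2.1 ++ q.1.1
  left_inv v := List.take_append_drop _ _
  right_inv q := by
    obtain ⟨⟨x, hx⟩, u, hu⟩ := q
    have h : (u.length + x.length) % s = u.length := by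
      obtain ⟨k, hk⟩ := hx
      rw [hk, Nat.add_mul_mod_self_left, Nat.mod_eq_of_lt hu]
    simp [h]

theorem treeEquiv_append {s : ℕ} (hs : 0 < s) (v : List (Fin d)) :
    (treeEquiv d hs v).2.1 ++ (treeEquiv d hs v).1.1 = v :=
  (treeEquiv d hs).symm_apply_apply v

theorem length_treeEquiv_fst {s : ℕ} (hs : 0 < s) (v : List (Fin d)) :
    (treeEquiv d hs v).1.1.length = s * (v.length / s) := by
  change (v.drop (v.length % s)).length = _
  rw [List.length_drop]
  have := Nat.div_add_mod v.length s
  omega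

theorem exists_suffix_length {α : Type*} (w : List α) {m : ℕ} (h : m ≤ w.length) :
    ∃ y, y <:+ w ∧ y.length = m :=
  ⟨w.drop (w.length - m), List.drop_suffix _ _, by rw [List.length_drop]; omega⟩

theorem measurableSet_of_fintype {F : Type*} [Finite F] (S : Set (F → Bool)) : MeasurableSet S :=
  S.toFinite.measurableSet

/-- The configurations of a block in which every path from the root to the last level meets a
closed vertex. -/
def blocking (d s : ℕ) : Set (Words d s → Bool) :=
  {η | ∀ w : Words d s, w.1.length + 1 = s → ∃ u : Words d s, u.1 <:+ w.1 ∧ η u = false}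

/-- Ancestors are suffixes. The length of y places it on the last level of a block of generation i,
so its path crosses that whole block. -/
theorem exists_closed_suffix {s : ℕ} (hs : 0 < s) {ω : List (Fin d) → Bool} {y : List (Fin d)}
    {i : ℕ} (hy : y.length + 1 = s * (i + 1))
    (h : ∀ x : {x : List (Fin d) // s ∣ x.length}, x.1.length = s * i →
      cell (treeEquiv d hs) ω x ∈ blocking d s) :
    ∃ u, u <:+ y ∧ s * i ≤ u.length ∧ ω u = false := by
  have hdiv : y.length / s = i := by
    rw [Nat.div_eq_iff hs]
    rw [mul_add, mul_one, mul_comm] at hy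
    omega
  have hlen := length_treeEquiv_fst hs y
  rw [hdiv] at hlen
  have happ := treeEquiv_append hs y
  obtain ⟨u, hu, hu'⟩ := h _ hlen (treeEquiv d hs y).2 (by
    have := congrArg List.length happ
    rw [List.length_append, hlen] at this
    rw [mul_add, mul_one] at hy
    omega)
  refine ⟨u.1 ++ (treeEquiv d hs y).1.1, ?_, ?_, hu'⟩
  · conv_rhs => rw [← happ]
    obtain ⟨t, ht⟩ := hu
    exact ⟨t, by rw [← ht, List.append_assoc]⟩
  · rw [List.length_append, hlen]; omega

theorem measurable_restrict (s : ℕ) :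
    Measurable fun (ω : List (Fin d) → Bool) (u : Words d s) => ω u.1 :=
  measurable_pi_lambda _ fun _ => measurable_pi_apply _

theorem exists_blocking {P : ℝ≥0∞} (h0 : 0 < P) (h1 : P < 1) (j : ℕ) :
    ∃ (s : ℕ) (_ : 0 < s) (κ : Measure (Words d s → Bool)), KWise j P κ ∧
      ∀ᵐ η ∂κ, η ∈ blocking d s := by
  induction j with
  | zero =>
    refine ⟨1, one_pos, Measure.dirac fun _ => false, ⟨inferInstance, fun S hS => ?_⟩, ?_⟩
    · obtain rfl : S = ∅ := by simpa using hS
      simp [openOn]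
    · rw [ae_dirac_eq]
      exact fun w _ => ⟨w, List.suffix_refl _, rfl⟩
  | succ j ih =>
    obtain ⟨s, hs, κ, hκ, hΩ⟩ := ih
    have := hκ.prob
    obtain ⟨ρ, hρ0, hρ1, hρ⟩ := exists_complement h0 h1 κ
    obtain ⟨n, hn0, hn⟩ := exists_natCast_div_le 1 hρ0
    have : Nonempty (Fin n) := ⟨⟨0, hn0⟩⟩
    -- The label i selects the generations congruent to i modulo n. Each block has exactly one
    -- label, hence density 1 / n, and a subtree of height s * n contains one complete selected
    -- generation.
    obtain ⟨R, hR⟩ : ∃ R : Fin n → Set {x : List (Fin d) // s ∣ x.length},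
        ∀ i x, x ∈ R i ↔ x.1.length / s % n = i :=
      ⟨fun i => {x | x.1.length / s % n = i}, fun _ _ => Iff.rfl⟩
    classical
    obtain ⟨κ', hprob, hκ', hK⟩ := exists_boost (treeEquiv d hs) hκ hρ1 hρ R
      (fun x => le_trans (by
        rw [Fintype.card_fin]
        gcongr
        rw [Finset.card_le_one]
        intro a ha b hb
        rw [Finset.mem_filter, hR] at ha hb
        exact Fin.ext (ha.2.symm.trans hb.2)) hn)
    have hae := ae_boost_cells (treeEquiv d hs) hΩ hκ' (Fintype.card (Fin n) : ℝ≥0∞)⁻¹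
    refine ⟨s * n, Nat.mul_pos hs hn0, _,
      hK.comap (f := fun u : Words d (s * n) => u.1) Subtype.val_injective, ?_⟩
    rw [ae_map_iff (measurable_restrict _).aemeasurable (measurableSet_of_fintype _)]
    filter_upwards [hae] with ω ⟨i, hi⟩ w hw
    have hin : s * (i + 1) ≤ s * n := Nat.mul_le_mul_left _ i.2
    have hpos : 0 < s * (i + 1 : ℕ) := Nat.mul_pos hs (Nat.succ_pos _)
    obtain ⟨y, hy, hylen⟩ := exists_suffix_length w.1 (m := s * (i + 1) - 1) (by omega)
    obtain ⟨u, hu, -, hu'⟩ := exists_closed_suffix hs (ω := ω) (y := y) (i := i) (by omega)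
      (fun x hx => hi x (by
        rw [hR, hx, Nat.mul_div_cancel_left _ hs, Nat.mod_eq_of_lt i.2]))
    exact ⟨⟨u, (hu.trans hy).length_le.trans_lt w.2⟩, hu.trans hy, hu'⟩

/-- The subtree below u can be entered from outside only through u. -/
theorem Reach.open_of_suffix {ω : List (Fin d) → Bool} {v v' u : List (Fin d)}
    (h : Reach (aryTree d) ω v v') (hu : u <:+ v') (hv : ¬ u <:+ v) : ω u = true := by
  induction h with
  | refl => exact absurd hu hv
  | tail _ hbc ih =>
    obtain ⟨⟨a, rfl⟩ | ⟨a, rfl⟩, -, hc⟩ := hbc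
    · rcases List.suffix_cons_iff.1 hu with rfl | hu
      exacts [hc, ih hu]
    · exact ih (hu.trans (List.suffix_cons _ _))

theorem exists_no_infinite_cluster_tree {P : ℝ≥0∞} (h0 : 0 < P) (h1 : P < 1) (j : ℕ) :
    ∃ Q : Measure (List (Fin d) → Bool), KWise j P Q ∧
      ∀ᵐ ω ∂Q, ¬ HasInfiniteOpenCluster (aryTree d) ω := by
  obtain ⟨s, hs, κ, hκ, hΩ⟩ := exists_blocking (d := d) h0 h1 j
  have := hκ.prob
  refine ⟨tileLaw (treeEquiv d hs) fun _ => κ, KWise.tileLaw _ fun _ => hκ, ?_⟩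
  have hall : ∀ᵐ ω ∂tileLaw (treeEquiv d hs) fun _ => κ, ∀ x,
      cell (treeEquiv d hs) ω x ∈ blocking d s :=
    ae_all_iff.2 fun x => tileLaw_ae_cell _ _ x hΩ
  filter_upwards [hall] with ω hω
  rw [hasInfiniteOpenCluster_iff]
  rintro ⟨v, -, hv⟩
  -- Words of bounded length are finite in number. A depth of 2 * s below v leaves room for a full
  -- generation starting strictly below v.
  obtain ⟨v', hv', hlen⟩ : ∃ v', Reach (aryTree d) ω v v' ∧ v.length + 2 * s < v'.length := by
    by_contra! hcon
    exact hv ((List.finite_length_le (Fin d) (v.length + 2 * s)).subset fun v' h => hcon v' h)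
  have hdm := Nat.div_add_mod v.length s
  have hml := Nat.mod_lt v.length hs
  set i := v.length / s + 1 with hi
  have hsi : s * i = s * (v.length / s) + s := by rw [hi]; ring
  have hsi' : s * (i + 1) = s * i + s := by ring
  obtain ⟨y, hy, hylen⟩ := exists_suffix_length v' (m := s * (i + 1) - 1) (by omega)
  obtain ⟨u, hu, hul, hu'⟩ := exists_closed_suffix hs (ω := ω) (y := y) (i := i) (by omega)
    (fun x _ => hω x)
  have := hv'.open_of_suffix (hu.trans hy) fun h => by
    have := h.length_le
    omega
  simp [hu'] at this

end Tree

/-! ### Percolation on the tree by the second moment method -/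

section TreePercolation

variable {d : ℕ}

/-- The words of length `m`. -/
def wordsLen (d m : ℕ) : Finset (List (Fin d)) :=
  (Finset.univ : Finset (Fin m → Fin d)).map ⟨List.ofFn, List.ofFn_injective⟩

theorem mem_wordsLen {m : ℕ} {w : List (Fin d)} : w ∈ wordsLen d m ↔ w.length = m := by
  simp only [wordsLen, Finset.mem_map, Finset.mem_univ, true_and]
  constructor
  · rintro ⟨v, rfl⟩
    exact List.length_ofFn
  · rintro rfl
    exact ⟨w.get, List.ofFn_get w⟩

theorem card_wordsLen (m : ℕ) : (wordsLen d m).card = d ^ m := by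
  simp [wordsLen]

theorem sum_wordsLen_add {M : Type*} [AddCommMonoid M] (s m : ℕ) (f : List (Fin d) → M) :
    ∑ w ∈ wordsLen d (s + m), f w = ∑ y ∈ wordsLen d m, ∑ c ∈ wordsLen d s, f (c ++ y) := by
  rw [← Finset.sum_product']
  refine (Finset.sum_bij' (fun q _ => q.2 ++ q.1) (fun w _ => (w.drop s, w.take s))
    ?_ ?_ ?_ ?_ ?_).symm
  · intro q hq
    rw [Finset.mem_product, mem_wordsLen, mem_wordsLen] at hq
    rw [mem_wordsLen, List.length_append, hq.1, hq.2]
  · intro w hw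
    rw [mem_wordsLen] at hw
    rw [Finset.mem_product, mem_wordsLen, mem_wordsLen, List.length_drop, List.length_take, hw]
    omega
  · intro q hq
    rw [Finset.mem_product, mem_wordsLen, mem_wordsLen] at hq
    simp [← hq.2]
  · intro w _
    exact List.take_append_drop _ _
  · intro _ _; rfl

/-- The configurations of a block in which the path from the root towards `c` is open. -/
def through (s : ℕ) (c : List (Fin d)) : Set (Words d s → Bool) :=
  {η | ∀ u : Words d s, u.1 <:+ c → η u = true}

/-- The configurations in which the proper suffixes of `w` of length at least `l` are open. -/
def pathFrom (l : ℕ) (w : List (Fin d)) : Set (List (Fin d) → Bool) :=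
  {ω | ∀ u, u <:+ w → l ≤ u.length → u.length < w.length → ω u = true}

theorem pathFrom_self (w : List (Fin d)) : pathFrom w.length w = Set.univ :=
  Set.eq_univ_of_forall fun _ _ _ h1 h2 => absurd h2 (not_lt.2 h1)

/-- The endpoint is not required to be open, so the path to y uses no vertex of the block rooted at
y; the remainder is a crossing of exactly that block. -/
theorem pathFrom_append {s l : ℕ} (hs : 0 < s) {c y : List (Fin d)} (hc : c.length = s)
    (hl : l ≤ y.length) (hy : s ∣ y.length) :
    pathFrom l (c ++ y) =
      pathFrom l y ∩ {ω | cell (treeEquiv d hs) ω ⟨y, hy⟩ ∈ through s c} := by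
  ext ω
  constructor
  · refine fun h => ⟨fun u hu h1 h2 => h u (hu.trans (List.suffix_append _ _)) h1 ?_,
      fun u hu => h (u.1 ++ y) ?_ ?_ ?_⟩
    · rw [List.length_append]; omega
    · obtain ⟨t, ht⟩ := hu
      exact ⟨t, by rw [← List.append_assoc, ht]⟩
    · rw [List.length_append]; omega
    · have := u.2
      rw [List.length_append, List.length_append]; omega
  · rintro ⟨h1, h2⟩ u hu hlu hlt
    rcases lt_or_ge u.length y.length with h | h
    · exact h1 u (List.suffix_of_suffix_length_le hu (List.suffix_append _ _) h.le) hlu h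
    · obtain ⟨u', rfl⟩ := List.suffix_of_suffix_length_le (List.suffix_append c y) hu h
      obtain ⟨t, ht⟩ := hu
      rw [← List.append_assoc] at ht
      rw [List.length_append, List.length_append] at hlt
      exact h2 ⟨u', by omega⟩ ⟨t, List.append_cancel_right ht⟩

section Cylinder

variable {V W F : Type*}

/-- An intersection of events each of which concerns one cell, these being finitely many cells
in `A`. -/
def IsCylinder (e : V ≃ W × F) (A : Set W) (E : Set (V → Bool)) : Prop :=
  ∃ (B : Finset W) (t : W → Set (F → Bool)), (∀ w ∈ B, w ∈ A) ∧ (∀ w ∉ B, t w = Set.univ) ∧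
    E = {ω | ∀ w, cell e ω w ∈ t w}

variable {e : V ≃ W × F} {A A' : Set W} {E E' : Set (V → Bool)}

theorem IsCylinder.univ : IsCylinder e A Set.univ :=
  ⟨∅, fun _ => Set.univ, by simp, by simp, by simp⟩

theorem IsCylinder.mono (h : IsCylinder e A E) (hA : A ⊆ A') : IsCylinder e A' E := by
  obtain ⟨B, t, h1, h2, h3⟩ := h
  exact ⟨B, t, fun w hw => hA (h1 w hw), h2, h3⟩

theorem IsCylinder.inter (h : IsCylinder e A E) (h' : IsCylinder e A E') :
    IsCylinder e A (E ∩ E') := by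
  classical
  obtain ⟨B, t, h1, h2, rfl⟩ := h
  obtain ⟨B', t', h1', h2', rfl⟩ := h'
  refine ⟨B ∪ B', fun w => t w ∩ t' w, fun w hw => ?_, fun w hw => ?_, ?_⟩
  · rcases Finset.mem_union.1 hw with h | h
    exacts [h1 w h, h1' w h]
  · rw [Finset.mem_union, not_or] at hw
    simp only [h2 w hw.1, h2' w hw.2, Set.univ_inter]
  · ext ω
    exact ⟨fun h w => ⟨h.1 w, h.2 w⟩, fun h => ⟨fun w => (h w).1, fun w => (h w).2⟩⟩

theorem isCylinder_cell {w : W} (hw : w ∈ A) (S : Set (F → Bool)) :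
    IsCylinder e A {ω | cell e ω w ∈ S} := by
  classical
  refine ⟨{w}, Function.update (fun _ => Set.univ) w S, by simpa, fun w' hw' => ?_, ?_⟩
  · rw [Finset.mem_singleton] at hw'
    rw [Function.update_of_ne hw']
  · ext ω
    refine ⟨fun h w' => ?_, fun h => by simpa using h w⟩
    by_cases hww : w' = w
    · subst hww; simpa using h
    · simp [hww]

theorem IsCylinder.measurableSet [Finite F] (h : IsCylinder e A E) : MeasurableSet E := by
  obtain ⟨B, t, -, h2, rfl⟩ := h
  have : {ω | ∀ w, cell e ω w ∈ t w} = ⋂ w ∈ B, (fun ω => cell e ω w) ⁻¹' t w := by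
    ext ω
    simp only [Set.mem_iInter]
    refine ⟨fun h w _ => h w, fun h w => ?_⟩
    by_cases hw : w ∈ B
    · exact h w hw
    · rw [h2 w hw]; trivial
  rw [this]
  exact Finset.measurableSet_biInter _ fun w _ => measurable_cell e w (measurableSet_of_fintype _)

theorem IsCylinder.tileLaw_inter_cell [Finite F] {κ : Measure (F → Bool)} [IsProbabilityMeasure κ]
    (h : IsCylinder e A E) {w : W} (hw : w ∉ A) (S : Set (F → Bool)) :
    (tileLaw e fun _ => κ).real (E ∩ {ω | cell e ω w ∈ S}) =
      (tileLaw e fun _ => κ).real E * κ.real S := by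
  classical
  obtain ⟨B, t, h1, h2, rfl⟩ := h
  have hwB : w ∉ B := fun h => hw (h1 w h)
  have hup : ∀ w' ∈ B, Function.update t w S w' = t w' := fun w' hw' =>
    Function.update_of_ne (by rintro rfl; exact hwB hw') _ _
  have hB : {ω | ∀ w, cell e ω w ∈ t w} = {ω | ∀ w ∈ B, cell e ω w ∈ t w} := by
    ext ω
    refine ⟨fun h w _ => h w, fun h w => ?_⟩
    by_cases hw : w ∈ B
    · exact h w hw
    · rw [h2 w hw]; trivial
  have hi : {ω | ∀ w, cell e ω w ∈ t w} ∩ {ω | cell e ω w ∈ S} =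
      {ω | ∀ w' ∈ insert w B, cell e ω w' ∈ Function.update t w S w'} := by
    rw [hB]
    ext ω
    simp only [Set.mem_inter_iff, Set.mem_ofPred_eq, Finset.forall_mem_insert,
      Function.update_self]
    rw [and_comm]
    refine and_congr_right fun _ => forall₂_congr fun w' hw' => ?_
    rw [hup w' hw']
  rw [Measure.real, Measure.real, Measure.real, hi, hB,
    tileLaw_cells _ _ _ _ fun _ _ => measurableSet_of_fintype _,
    tileLaw_cells _ _ _ _ fun _ _ => measurableSet_of_fintype _,
    Finset.prod_insert hwB, Function.update_self, mul_comm, ENNReal.toReal_mul]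
  congr 2
  exact Finset.prod_congr rfl fun w' hw' => by rw [hup w' hw']

end Cylinder

/-- Only blocks of earlier generations matter, which makes the event independent of the blocks
rooted at the level of w. -/
theorem isCylinder_pathFrom {s : ℕ} (hs : 0 < s) (g n : ℕ) {w : List (Fin d)}
    (hw : w.length = s * (g + n)) :
    IsCylinder (treeEquiv d hs) {x | x.1.length < s * (g + n)} (pathFrom (s * g) w) := by
  induction n generalizing w with
  | zero =>
    rw [add_zero] at hw
    rw [← hw, pathFrom_self]
    exact .univ
  | succ n ih =>
    have hsn : s * (g + (n + 1)) = s * (g + n) + s := by ring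
    obtain ⟨y, ⟨c, rfl⟩, hy⟩ := exists_suffix_length w (m := s * (g + n)) (by omega)
    rw [List.length_append] at hw
    rw [pathFrom_append hs (by omega) (by rw [hy]; exact Nat.mul_le_mul_left _ (by omega))
      ⟨_, hy⟩]
    refine ((ih hy).mono fun x hx => ?_).inter (isCylinder_cell ?_ _)
    · have hx' : x.1.length < s * (g + n) := hx
      change x.1.length < s * (g + (n + 1))
      omega
    · change y.length < s * (g + (n + 1))
      omega

/-- The expected number of open paths through a block. -/
noncomputable def meanPaths {s : ℕ} (κ : Measure (Words d s → Bool)) : ℝ :=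
  ∑ c ∈ wordsLen d s, κ.real (through s c)

section Moments

variable {s : ℕ} (hs : 0 < s) (κ : Measure (Words d s → Bool)) [IsProbabilityMeasure κ]

theorem real_pathFrom_append (g n : ℕ) {c y : List (Fin d)} (hc : c.length = s)
    (hy : y.length = s * (g + n)) :
    (tileLaw (treeEquiv d hs) fun _ => κ).real (pathFrom (s * g) (c ++ y)) =
      (tileLaw (treeEquiv d hs) fun _ => κ).real (pathFrom (s * g) y) * κ.real (through s c) := by
  rw [pathFrom_append hs hc (by rw [hy]; exact Nat.mul_le_mul_left _ (by omega)) ⟨_, hy⟩]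
  refine (isCylinder_pathFrom hs g n hy).tileLaw_inter_cell ?_ _
  exact fun h : y.length < _ => by omega

theorem real_pathFrom_append_inter (g n : ℕ) {c y c' y' : List (Fin d)} (hc : c.length = s)
    (hy : y.length = s * (g + n)) (hc' : c'.length = s) (hy' : y'.length = s * (g + n))
    (hne : y ≠ y') :
    (tileLaw (treeEquiv d hs) fun _ => κ).real
        (pathFrom (s * g) (c ++ y) ∩ pathFrom (s * g) (c' ++ y')) =
      (tileLaw (treeEquiv d hs) fun _ => κ).real (pathFrom (s * g) y ∩ pathFrom (s * g) y') *
        (κ.real (through s c) * κ.real (through s c')) := by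
  have hle : s * g ≤ s * (g + n) := Nat.mul_le_mul_left _ (by omega)
  rw [pathFrom_append hs hc (hle.trans hy.ge) ⟨_, hy⟩,
    pathFrom_append hs hc' (hle.trans hy'.ge) ⟨_, hy'⟩, Set.inter_inter_inter_comm,
    ← Set.inter_assoc]
  have h1 := (isCylinder_pathFrom hs g n hy).inter (isCylinder_pathFrom hs g n hy')
  have h2 := (h1.mono (Set.subset_insert ⟨y, ⟨_, hy⟩⟩ _)).inter
    (isCylinder_cell (Set.mem_insert _ _) (through s c))
  rw [h2.tileLaw_inter_cell, h1.tileLaw_inter_cell, mul_assoc]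
  · exact fun h : y.length < _ => by omega
  · rintro (h | h)
    · exact hne (congrArg Subtype.val h).symm
    · exact absurd (show y'.length < _ from h) (by omega)

/-- The expected number of open paths between two levels. -/
noncomputable def firstMoment (g n : ℕ) : ℝ :=
  ∑ w ∈ wordsLen d (s * (g + n)),
    (tileLaw (treeEquiv d hs) fun _ => κ).real (pathFrom (s * g) w)

/-- The second moment of the number of open paths between two levels. -/
noncomputable def secondMoment (g n : ℕ) : ℝ :=
  ∑ w ∈ wordsLen d (s * (g + n)), ∑ w' ∈ wordsLen d (s * (g + n)),
    (tileLaw (treeEquiv d hs) fun _ => κ).real (pathFrom (s * g) w ∩ pathFrom (s * g) w')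

theorem pathFrom_eq_univ {g : ℕ} {w : List (Fin d)} (hw : w ∈ wordsLen d (s * (g + 0))) :
    pathFrom (s * g) w = Set.univ := by
  rw [mem_wordsLen, add_zero] at hw
  rw [← hw, pathFrom_self]

theorem mul_add_succ (s g n : ℕ) : s * (g + (n + 1)) = s + s * (g + n) := by ring

theorem firstMoment_eq (g n : ℕ) :
    firstMoment hs κ g n = d ^ (s * g) * meanPaths κ ^ n := by
  induction n with
  | zero =>
    rw [firstMoment, Finset.sum_congr rfl fun w hw => by rw [pathFrom_eq_univ hw]]
    simp [card_wordsLen]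
  | succ n ih =>
    rw [pow_succ, ← mul_assoc, ← ih, firstMoment, firstMoment, mul_add_succ, sum_wordsLen_add,
      meanPaths, Finset.sum_mul_sum]
    refine Finset.sum_congr rfl fun y hy => Finset.sum_congr rfl fun c hc => ?_
    rw [mem_wordsLen] at hy hc
    exact real_pathFrom_append hs κ g n hc hy

theorem secondMoment_zero (g : ℕ) : secondMoment hs κ g 0 = (d ^ (s * g)) ^ 2 := by
  rw [secondMoment, Finset.sum_congr rfl fun w hw => Finset.sum_congr rfl fun w' hw' => by
    rw [pathFrom_eq_univ hw, pathFrom_eq_univ hw']]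
  simp [card_wordsLen, sq]

/-- Pairs extending distinct words use different, independent blocks and contribute the factor M ^
2. Each y has (d ^ s) ^ 2 pairs of extensions, each bounded by the probability of the path to y. -/
theorem secondMoment_succ_le (g n : ℕ) :
    secondMoment hs κ g (n + 1) ≤ meanPaths κ ^ 2 * secondMoment hs κ g n +
      (d ^ s) ^ 2 * firstMoment hs κ g n := by
  set T := tileLaw (treeEquiv d hs) fun _ => κ with hT
  set Y := wordsLen d (s * (g + n)) with hY
  set C := wordsLen d s with hC
  have hbound : ∀ y ∈ Y, ∀ c ∈ C, ∀ y' ∈ Y, ∀ c' ∈ C,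
      T.real (pathFrom (s * g) (c ++ y) ∩ pathFrom (s * g) (c' ++ y')) ≤
        T.real (pathFrom (s * g) y ∩ pathFrom (s * g) y') *
          (κ.real (through s c) * κ.real (through s c')) +
        if y = y' then T.real (pathFrom (s * g) y) else 0 := by
    intro y hy c hc y' hy' c' hc'
    rw [hY, mem_wordsLen] at hy hy'
    rw [hC, mem_wordsLen] at hc hc'
    split_ifs with h
    · refine le_add_of_nonneg_of_le (by positivity) (measureReal_mono ?_)
      rw [pathFrom_append hs hc (by rw [hy]; exact Nat.mul_le_mul_left _ (by omega)) ⟨_, hy⟩]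
      exact fun ω hω => hω.1.1
    · rw [add_zero]
      exact (real_pathFrom_append_inter hs κ g n hc hy hc' hy' h).le
  calc secondMoment hs κ g (n + 1)
      = ∑ y ∈ Y, ∑ c ∈ C, ∑ y' ∈ Y, ∑ c' ∈ C,
          T.real (pathFrom (s * g) (c ++ y) ∩ pathFrom (s * g) (c' ++ y')) := by
        rw [secondMoment, mul_add_succ, sum_wordsLen_add]
        refine Finset.sum_congr rfl fun y _ => Finset.sum_congr rfl fun c _ => ?_
        rw [sum_wordsLen_add]
    _ ≤ ∑ y ∈ Y, ∑ c ∈ C, ∑ y' ∈ Y, ∑ c' ∈ C,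
          (T.real (pathFrom (s * g) y ∩ pathFrom (s * g) y') *
            (κ.real (through s c) * κ.real (through s c')) +
          if y = y' then T.real (pathFrom (s * g) y) else 0) :=
        Finset.sum_le_sum fun y hy => Finset.sum_le_sum fun c hc =>
          Finset.sum_le_sum fun y' hy' => Finset.sum_le_sum fun c' hc' =>
            hbound y hy c hc y' hy' c' hc'
    _ = meanPaths κ ^ 2 * secondMoment hs κ g n + (d ^ s) ^ 2 * firstMoment hs κ g n := by
        have h1 : ∀ y, ∑ c ∈ C, ∑ y' ∈ Y, ∑ c' ∈ C,
            T.real (pathFrom (s * g) y ∩ pathFrom (s * g) y') *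
              (κ.real (through s c) * κ.real (through s c')) =
            meanPaths κ ^ 2 * ∑ y' ∈ Y, T.real (pathFrom (s * g) y ∩ pathFrom (s * g) y') := by
          intro y
          rw [Finset.sum_comm, Finset.mul_sum]
          refine Finset.sum_congr rfl fun y' _ => ?_
          rw [sq, meanPaths, Finset.sum_mul_sum, Finset.sum_mul]
          refine Finset.sum_congr rfl fun c _ => ?_
          rw [Finset.sum_mul]
          exact Finset.sum_congr rfl fun c' _ => mul_comm _ _
        have h2 : ∀ y ∈ Y, ∑ c ∈ C, ∑ y' ∈ Y, ∑ c' ∈ C,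
            (if y = y' then T.real (pathFrom (s * g) y) else 0) =
            (d ^ s) ^ 2 * T.real (pathFrom (s * g) y) := by
          intro y hy
          simp only [Finset.sum_const, nsmul_eq_mul, hC, card_wordsLen]
          rw [← Finset.mul_sum, Finset.sum_ite_eq, if_pos hy]
          push_cast
          ring
        simp only [Finset.sum_add_distrib]
        rw [Finset.sum_congr rfl fun y _ => h1 y, Finset.sum_congr rfl h2, ← Finset.mul_sum,
          ← Finset.mul_sum]
        rfl

/-- The right side solves the recursion of `secondMoment_succ_le` with equality; M > 1 makes its
denominator nonzero. -/
theorem secondMoment_sub_le (hM : 1 < meanPaths κ) (g n : ℕ) :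
    secondMoment hs κ g n - firstMoment hs κ g n ^ 2 ≤
      (d ^ s) ^ 2 / (meanPaths κ ^ 2 - meanPaths κ) * d ^ (s * g) *
        (meanPaths κ ^ (2 * n) - meanPaths κ ^ n) := by
  have hM2 : meanPaths κ ^ 2 - meanPaths κ ≠ 0 := by nlinarith
  induction n with
  | zero => rw [secondMoment_zero, firstMoment_eq]; simp
  | succ n ih =>
    have h1 := secondMoment_succ_le hs κ g n
    rw [firstMoment_eq] at *
    set M := meanPaths κ
    set R : ℝ := d ^ (s * g)
    have h2 := mul_le_mul_of_nonneg_left ih (sq_nonneg M)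
    have h3 : (d ^ s : ℝ) ^ 2 / (M ^ 2 - M) * R * (M ^ (2 * (n + 1)) - M ^ (n + 1)) =
        M ^ 2 * ((d ^ s) ^ 2 / (M ^ 2 - M) * R * (M ^ (2 * n) - M ^ n)) +
          (d ^ s) ^ 2 * (R * M ^ n) := by
      have hK := div_mul_cancel₀ ((d ^ s : ℝ) ^ 2) hM2
      generalize (d ^ s : ℝ) ^ 2 / (M ^ 2 - M) = K at hK ⊢
      rw [← hK]
      ring
    rw [h3]
    have h4 : (R * M ^ (n + 1)) ^ 2 = M ^ 2 * (R * M ^ n) ^ 2 := by ring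
    rw [h4]
    linarith

/-- The event that there is no open path between two levels. -/
def noPath (d s g n : ℕ) : Set (List (Fin d) → Bool) :=
  {ω | ∀ w ∈ wordsLen d (s * (g + n)), ω ∉ pathFrom (s * g) w}

/-- Chebyshev's argument: with Z the number of open paths and b its mean, the indicator of Z = 0
times b ^ 2 is at most (Z - b) ^ 2. -/
theorem real_noPath_mul_le (g n : ℕ) :
    (tileLaw (treeEquiv d hs) fun _ => κ).real (noPath d s g n) * firstMoment hs κ g n ^ 2 ≤
      secondMoment hs κ g n - firstMoment hs κ g n ^ 2 := by
  set T := tileLaw (treeEquiv d hs) fun _ => κ with hT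
  set Y := wordsLen d (s * (g + n)) with hY
  set b := firstMoment hs κ g n with hb
  have hO : ∀ w ∈ Y, MeasurableSet (pathFrom (s * g) w) := fun w hw =>
    (isCylinder_pathFrom hs g n (mem_wordsLen.1 hw)).measurableSet
  have hZ : MeasurableSet (noPath d s g n) := by
    have : noPath d s g n = ⋂ w ∈ Y, (pathFrom (s * g) w)ᶜ := by
      ext ω
      simp only [Set.mem_iInter]
      rfl
    rw [this]
    exact Finset.measurableSet_biInter _ fun w hw => (hO w hw).compl
  have hint : ∀ E : Set (List (Fin d) → Bool), MeasurableSet E →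
      Integrable (E.indicator (1 : (List (Fin d) → Bool) → ℝ)) T := fun E hE =>
    (integrable_const (1 : ℝ)).indicator hE
  have i2 : Integrable (fun ω => ∑ w ∈ Y, ∑ w' ∈ Y,
      (pathFrom (s * g) w ∩ pathFrom (s * g) w').indicator (1 : (List (Fin d) → Bool) → ℝ) ω) T :=
    integrable_finsetSum _ fun w hw => integrable_finsetSum _ fun w' hw' =>
      hint _ ((hO w hw).inter (hO w' hw'))
  have i1 : Integrable (fun ω => 2 * b * ∑ w ∈ Y,
      (pathFrom (s * g) w).indicator (1 : (List (Fin d) → Bool) → ℝ) ω) T :=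
    (integrable_finsetSum _ fun w hw => hint _ (hO w hw)).const_mul _
  have e2 : ∫ ω, ∑ w ∈ Y, ∑ w' ∈ Y,
      (pathFrom (s * g) w ∩ pathFrom (s * g) w').indicator (1 : (List (Fin d) → Bool) → ℝ) ω ∂T =
      secondMoment hs κ g n := by
    rw [integral_finsetSum _ fun w hw => integrable_finsetSum _ fun w' hw' =>
      hint _ ((hO w hw).inter (hO w' hw'))]
    refine Finset.sum_congr rfl fun w hw => ?_
    rw [integral_finsetSum _ fun w' hw' => hint _ ((hO w hw).inter (hO w' hw'))]
    exact Finset.sum_congr rfl fun w' hw' => integral_indicator_one ((hO w hw).inter (hO w' hw'))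
  have e1 : ∫ ω, 2 * b * ∑ w ∈ Y,
      (pathFrom (s * g) w).indicator (1 : (List (Fin d) → Bool) → ℝ) ω ∂T = 2 * b * b := by
    rw [integral_const_mul, integral_finsetSum _ fun w hw => hint _ (hO w hw)]
    congr 1
    exact Finset.sum_congr rfl fun w hw => integral_indicator_one (hO w hw)
  calc T.real (noPath d s g n) * b ^ 2
      = ∫ ω, (noPath d s g n).indicator (1 : (List (Fin d) → Bool) → ℝ) ω * b ^ 2 ∂T := by
        rw [integral_mul_const, integral_indicator_one hZ]
    _ ≤ ∫ ω, ((∑ w ∈ Y, ∑ w' ∈ Y,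
          (pathFrom (s * g) w ∩ pathFrom (s * g) w').indicator (1 : (List (Fin d) → Bool) → ℝ) ω) -
          2 * b * ∑ w ∈ Y, (pathFrom (s * g) w).indicator (1 : (List (Fin d) → Bool) → ℝ) ω +
          b ^ 2) ∂T := by
        refine integral_mono ((hint _ hZ).mul_const _) ((i2.sub i1).add (integrable_const _))
          fun ω => ?_
        have hsq : ∑ w ∈ Y, ∑ w' ∈ Y,
            (pathFrom (s * g) w ∩ pathFrom (s * g) w').indicator (1 : (List (Fin d) → Bool) → ℝ) ω =
            (∑ w ∈ Y, (pathFrom (s * g) w).indicator (1 : (List (Fin d) → Bool) → ℝ) ω) ^ 2 := by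
          rw [sq, Finset.sum_mul_sum]
          simp only [Set.inter_indicator_one, Pi.mul_apply]
        simp only [hsq]
        by_cases hω : ω ∈ noPath d s g n
        · rw [Finset.sum_eq_zero fun w hw => Set.indicator_of_notMem (hω w hw) _,
            Set.indicator_of_mem hω]
          simp
        · rw [Set.indicator_of_notMem hω]
          nlinarith [sq_nonneg (∑ w ∈ Y,
            (pathFrom (s * g) w).indicator (1 : (List (Fin d) → Bool) → ℝ) ω - b)]
    _ = secondMoment hs κ g n - b ^ 2 := by
        refine (integral_add (i2.sub i1) (integrable_const (b ^ 2))).trans ?_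
        rw [integral_sub' i2 i1, e1, e2]
        simp
        ring

/-- The bound is uniform in n and decays in g, thanks to the d ^ (s * g) starting points. -/
theorem real_noPath_le (hM : 1 < meanPaths κ) (hd : 0 < d) (g n : ℕ) :
    (tileLaw (treeEquiv d hs) fun _ => κ).real (noPath d s g n) ≤
      (d ^ s) ^ 2 / (meanPaths κ ^ 2 - meanPaths κ) / d ^ (s * g) := by
  have h1 := (real_noPath_mul_le hs κ g n).trans (secondMoment_sub_le hs κ hM g n)
  rw [firstMoment_eq] at h1
  set M := meanPaths κ
  have hR : (0 : ℝ) < d ^ (s * g) := by positivity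
  set R : ℝ := d ^ (s * g)
  have hM0 : 0 < M := by linarith
  have hMM : 0 < M ^ 2 - M := by nlinarith
  set K : ℝ := (d ^ s) ^ 2 / (M ^ 2 - M)
  have hK : 0 ≤ K := by positivity
  rw [le_div_iff₀ hR]
  have h2 : K * R * (M ^ (2 * n) - M ^ n) ≤ K * R * M ^ (2 * n) := by
    have : 0 < M ^ n := by positivity
    gcongr
    linarith
  have h3 := h1.trans h2
  have h4 : 0 < R * M ^ (2 * n) := by positivity
  refine le_of_mul_le_mul_right ?_ h4
  calc _ = (tileLaw (treeEquiv d hs) fun _ => κ).real (noPath d s g n) * (R * M ^ n) ^ 2 := by ring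
    _ ≤ _ := h3
    _ = _ := by ring

end Moments

theorem exists_one_lt_meanPaths (hd : 2 ≤ d) {P : ℝ≥0∞} (h0 : 0 < P) (h1 : P < 1) (j : ℕ) :
    ∃ (s : ℕ) (_ : 0 < s) (κ : Measure (Words d s → Bool)), KWise j P κ ∧ 1 < meanPaths κ := by
  induction j with
  | zero =>
    refine ⟨1, one_pos, Measure.dirac fun _ => true, ⟨inferInstance, fun S hS => ?_⟩, ?_⟩
    · obtain rfl : S = ∅ := by simpa using hS
      simp [openOn]
    · have h : ∀ c : List (Fin d),
          (Measure.dirac fun _ => true : Measure (Words d 1 → Bool)).real (through 1 c) = 1 :=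
        fun c => by
          rw [Measure.real, Measure.dirac_apply_of_mem, ENNReal.toReal_one]
          exact fun _ _ => rfl
      rw [meanPaths, Finset.sum_congr rfl fun c _ => h c]
      simp only [Finset.sum_const, card_wordsLen, pow_one, nsmul_eq_mul, mul_one]
      exact_mod_cast hd
  | succ j ih =>
    obtain ⟨s, hs, κ, hκ, hM⟩ := ih
    have := hκ.prob
    obtain ⟨ρ, hρ0, hρ1, hρ⟩ := exists_complement h0 h1 κ
    obtain ⟨N, hN0, hN⟩ := exists_natCast_div_le 1 hρ0
    have : Nonempty (Fin N) := ⟨⟨0, hN0⟩⟩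
    -- One label out of N uses κ in all blocks at once, the others in none.
    obtain ⟨R, hR⟩ : ∃ R : Fin N → Set {x : List (Fin d) // s ∣ x.length},
        ∀ i x, x ∈ R i ↔ i = ⟨0, hN0⟩ :=
      ⟨fun i => {_x | i = ⟨0, hN0⟩}, fun _ _ => Iff.rfl⟩
    classical
    obtain ⟨κ', hprob, hκ', hK⟩ := exists_boost (treeEquiv d hs) hκ hρ1 hρ R
      (fun x => le_trans (by
        rw [Fintype.card_fin]
        gcongr
        rw [Finset.card_le_one]
        intro a ha b hb
        rw [Finset.mem_filter, hR] at ha hb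
        exact ha.2.trans hb.2.symm) hN)
    have h0' : κ' ⟨0, hN0⟩ = fun _ => κ := funext fun x => hκ' _ _ ((hR _ _).2 rfl)
    rw [Fintype.card_fin] at hK
    set Q := (N : ℝ≥0∞)⁻¹ • ∑ i, tileLaw (treeEquiv d hs) (κ' i) with hQ
    have := hK.prob
    -- The label of weight 1 / N alone contributes M ^ n / N to the new mean; n generations make
    -- this exceed 1.
    obtain ⟨n, hn⟩ := pow_unbounded_of_one_lt (N : ℝ) hM
    have hNpos : (0 : ℝ) < N := by exact_mod_cast hN0
    have hn0 : 0 < n := by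
      rcases Nat.eq_zero_or_pos n with rfl | h
      · rw [pow_zero] at hn
        have : N < 1 := by exact_mod_cast hn
        omega
      · exact h
    refine ⟨s * n, Nat.mul_pos hs hn0, _,
      hK.comap (f := fun u : Words d (s * n) => u.1) Subtype.val_injective, ?_⟩
    have hc : ∀ c ∈ wordsLen d (s * (0 + n)), (N : ℝ)⁻¹ *
        (tileLaw (treeEquiv d hs) fun _ => κ).real (pathFrom (s * 0) c) ≤
        (Q.map fun ω (u : Words d (s * n)) => ω u.1).real (through (s * n) c) := by
      intro c hc
      rw [zero_add, mem_wordsLen] at hc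
      have hpre : (fun (ω : List (Fin d) → Bool) (u : Words d (s * n)) => ω u.1) ⁻¹'
          through (s * n) c = pathFrom (s * 0) c := by
        ext ω
        exact ⟨fun h u hu _ hlt => h ⟨u, hc ▸ hlt⟩ hu,
          fun h u hu => h u.1 hu (by simp) (hc.symm ▸ u.2)⟩
      rw [map_measureReal_apply (measurable_restrict _) (measurableSet_of_fintype _), hpre]
      simp only [Measure.real]
      have hle : (N : ℝ≥0∞)⁻¹ * (tileLaw (treeEquiv d hs) fun _ => κ) (pathFrom (s * 0) c) ≤
          Q (pathFrom (s * 0) c) := by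
        rw [hQ, Measure.smul_apply, Measure.finsetSum_apply, smul_eq_mul, ← h0']
        gcongr
        exact Finset.single_le_sum
          (f := fun i => (tileLaw (treeEquiv d hs) (κ' i)) (pathFrom (s * 0) c))
          (fun _ _ => zero_le) (Finset.mem_univ _)
      have := ENNReal.toReal_mono (measure_ne_top _ _) hle
      rwa [ENNReal.toReal_mul, ENNReal.toReal_inv, ENNReal.toReal_natCast] at this
    have hf := firstMoment_eq hs κ 0 n
    rw [mul_zero, pow_zero, one_mul] at hf
    have hsum := Finset.sum_le_sum hc
    rw [← Finset.mul_sum] at hsum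
    change (N : ℝ)⁻¹ * firstMoment hs κ 0 n ≤ _ at hsum
    rw [hf, zero_add] at hsum
    refine lt_of_lt_of_le ?_ hsum
    rw [inv_mul_eq_div, one_lt_div hNpos]
    exact hn

theorem reach_of_mem_pathFrom {ω : List (Fin d) → Bool} {x w u : List (Fin d)}
    (hω : ω ∈ pathFrom x.length w) (hx : x <:+ u) (hu : u <:+ w) (hlt : u.length < w.length) :
    Reach (aryTree d) ω x u := by
  obtain ⟨t, rfl⟩ := hx
  induction t with
  | nil => exact .refl
  | cons a t ih =>
    have hs : t ++ x <:+ w := (List.suffix_cons a _).trans hu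
    have hl : (t ++ x).length < w.length := by
      rw [List.cons_append, List.length_cons] at hlt
      omega
    refine (ih hs hl).tail ⟨Or.inl ⟨a, rfl⟩, hω _ hs ?_ hl, hω _ hu ?_ hlt⟩ <;> simp
    omega

theorem noPath_mono (s g : ℕ) : Monotone (noPath d s g) := by
  refine monotone_nat_of_le_succ fun n ω hω w hw h => ?_
  rw [mem_wordsLen] at hw
  have hle : s * (g + n) ≤ w.length := hw ▸ Nat.mul_le_mul_left _ (by omega)
  obtain ⟨y, hy, hyl⟩ := exists_suffix_length w hle
  exact hω y (mem_wordsLen.2 hyl) fun u hu h1 h2 =>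
    h u (hu.trans hy) h1 (h2.trans_le hy.length_le)

/-- There are finitely many starting points on level s * g, so one of them starts open paths of
every length: otherwise the maximum of the failing n would contradict h. -/
theorem hasInfiniteOpenCluster_of_notMem {s : ℕ} (hs : 0 < s) (g : ℕ) {ω : List (Fin d) → Bool}
    (h : ∀ n, ω ∉ noPath d s g n) : HasInfiniteOpenCluster (aryTree d) ω := by
  obtain ⟨x, hx, hxn⟩ : ∃ x ∈ wordsLen d (s * g), ∀ n, ∃ w, x <:+ w ∧ w.length = s * (g + n) ∧
      ω ∈ pathFrom (s * g) w := by
    by_contra! hcon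
    choose! n hn using hcon
    have hN := h ((wordsLen d (s * g)).sup n)
    simp only [noPath, Set.mem_ofPred_eq, not_forall, not_not] at hN
    obtain ⟨w, hw, hp⟩ := hN
    rw [mem_wordsLen] at hw
    obtain ⟨x, hx, hxl⟩ := exists_suffix_length w (m := s * g)
      (hw ▸ Nat.mul_le_mul_left _ (by omega))
    have hxm := mem_wordsLen.2 hxl
    have hle : n x ≤ (wordsLen d (s * g)).sup n := Finset.le_sup hxm
    obtain ⟨y, hy, hyl⟩ := exists_suffix_length w (m := s * (g + n x))
      (hw ▸ Nat.mul_le_mul_left _ (by omega))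
    refine hn x hxm y (List.suffix_of_suffix_length_le hx hy ?_) hyl ?_
    · rw [hxl, hyl]; exact Nat.mul_le_mul_left _ (by omega)
    · exact fun u hu h1 h2 => hp u (hu.trans hy) h1 (h2.trans_le hy.length_le)
  rw [mem_wordsLen] at hx
  have hlong : ∀ m, ∃ u, Reach (aryTree d) ω x u ∧ m ≤ u.length := by
    intro m
    obtain ⟨w, hxw, hwl, hp⟩ := hxn (m + 1)
    have h1 : m + 1 ≤ s * (m + 1) := Nat.le_mul_of_pos_left _ hs
    have h2 : s * (g + (m + 1)) = s * g + s * (m + 1) := by ring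
    obtain ⟨u, hu, hul⟩ := exists_suffix_length w (m := w.length - 1) (by omega)
    refine ⟨u, reach_of_mem_pathFrom (hx ▸ hp)
      (List.suffix_of_suffix_length_le hxw hu (by omega)) hu (by omega), by omega⟩
  rw [hasInfiniteOpenCluster_iff]
  refine ⟨x, ?_, fun hfin => ?_⟩
  · obtain ⟨w, hxw, hwl, hp⟩ := hxn 1
    refine hp x hxw hx.ge ?_
    rw [hx, hwl, mul_add, mul_one]
    omega
  · obtain ⟨m, hm⟩ := (hfin.image List.length).bddAbove
    obtain ⟨u, hu, hul⟩ := hlong (m + 1)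
    have := hm (Set.mem_image_of_mem _ hu)
    omega

/-- The absence of an infinite cluster lies in the increasing union over n of the no-path events
from level s * g. Its probability is at most C / d ^ (s * g) for every g, hence zero. -/
theorem exists_infinite_cluster_tree (hd : 2 ≤ d) {P : ℝ≥0∞} (h0 : 0 < P) (h1 : P < 1) (j : ℕ) :
    ∃ Q : Measure (List (Fin d) → Bool), KWise j P Q ∧
      ∀ᵐ ω ∂Q, HasInfiniteOpenCluster (aryTree d) ω := by
  obtain ⟨s, hs, κ, hκ, hM⟩ := exists_one_lt_meanPaths hd h0 h1 j
  have := hκ.prob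
  refine ⟨tileLaw (treeEquiv d hs) fun _ => κ, KWise.tileLaw _ fun _ => hκ, ?_⟩
  set T := tileLaw (treeEquiv d hs) fun _ => κ
  set C : ℝ := (d ^ s) ^ 2 / (meanPaths κ ^ 2 - meanPaths κ) with hC
  have hbound : ∀ g, T {ω | ¬ HasInfiniteOpenCluster (aryTree d) ω} ≤
      ENNReal.ofReal (C / d ^ (s * g)) := by
    intro g
    calc T {ω | ¬ HasInfiniteOpenCluster (aryTree d) ω} ≤ T (⋃ n, noPath d s g n) := by
          refine measure_mono fun ω hω => ?_
          by_contra hcon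
          exact hω (hasInfiniteOpenCluster_of_notMem hs g fun n hn =>
            hcon (Set.mem_iUnion.2 ⟨n, hn⟩))
      _ = ⨆ n, T (noPath d s g n) := (noPath_mono s g).measure_iUnion
      _ ≤ ENNReal.ofReal (C / d ^ (s * g)) := by
          refine iSup_le fun n => ?_
          rw [← ENNReal.ofReal_toReal (measure_ne_top T (noPath d s g n))]
          exact ENNReal.ofReal_le_ofReal (real_noPath_le hs κ hM (by omega) g n)
  have hlim : Filter.Tendsto (fun g : ℕ => ENNReal.ofReal (C / (d : ℝ) ^ (s * g))) Filter.atTop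
      (nhds 0) := by
    rw [← ENNReal.ofReal_zero]
    refine ENNReal.tendsto_ofReal ?_
    have hd1 : (1 : ℝ) < (d : ℝ) ^ s := one_lt_pow₀ (by exact_mod_cast hd) hs.ne'
    simp_rw [pow_mul]
    exact (tendsto_pow_atTop_atTop_of_one_lt hd1).const_div_atTop C
  rw [ae_iff]
  exact le_antisymm (ge_of_tendsto' hlim hbound) zero_le

end TreePercolation

theorem mainTheorem6 (d : ℕ) (hd : 1 ≤ d) (p : ℝ) (hp0 : 0 < p) (hp1 : p < 1) (k : ℕ) :
    ((2 ≤ d → ∃ Q ∈ kwisePercolation (Fin d → ℤ) k p,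
        ∀ᵐ ω ∂Q, HasInfiniteOpenCluster (latticeGraph d) ω) ∧
      ∃ Q ∈ kwisePercolation (Fin d → ℤ) k p,
        ∀ᵐ ω ∂Q, ¬ HasInfiniteOpenCluster (latticeGraph d) ω) ∧
    ((2 ≤ d → ∃ Q ∈ kwisePercolation (List (Fin d)) k p,
        ∀ᵐ ω ∂Q, HasInfiniteOpenCluster (aryTree d) ω) ∧
      ∃ Q ∈ kwisePercolation (List (Fin d)) k p,
        ∀ᵐ ω ∂Q, ¬ HasInfiniteOpenCluster (aryTree d) ω) := by
  have h0 : 0 < ENNReal.ofReal p := ENNReal.ofReal_pos.2 hp0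
  have h1 : ENNReal.ofReal p < 1 := by
    rwa [← ENNReal.ofReal_one, ENNReal.ofReal_lt_ofReal_iff one_pos]
  refine ⟨⟨fun hd2 => ?_, ?_⟩, fun hd2 => ?_, ?_⟩
  · obtain ⟨Q, hQ, h⟩ := exists_infinite_cluster_lattice hd2 h0 h1 (k + 1)
    exact ⟨Q, hQ.mem_kwisePercolation, h⟩
  · obtain ⟨Q, hQ, h⟩ := exists_no_infinite_cluster_lattice (d := d) h0 h1 (k + 1)
    exact ⟨Q, hQ.mem_kwisePercolation, h⟩
  · obtain ⟨Q, hQ, h⟩ := exists_infinite_cluster_tree hd2 h0 h1 (k + 1)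
    exact ⟨Q, hQ.mem_kwisePercolation, h⟩
  · obtain ⟨Q, hQ, h⟩ := exists_no_infinite_cluster_tree (d := d) h0 h1 (k + 1)
    exact ⟨Q, hQ.mem_kwisePercolation, h⟩
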